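/- A spacetime $(X,g)$ is a smooth manifold (Hausdorff, second countable, without boundary) with a smooth Lorentzian metric $g$ of signature $(-,+,\dots,+)$ and a time orientation, given by a continuous timelike vector field. For an open set $U\subseteq X$ write $x\ll_U y$ if there is a piecewise smooth future-directed timelike curve in $U$ from $x$ to $y$, and $x\le_U y$ if $x=y$ or there is a piecewise smooth future-directed causal curve in $U$ from $x$ to $y$. A continuous path $c\colon[0,1]\to X$ is future-directed timelike (respectively causal) if for every $t_0\in[0,1]$ and every open neighbourhood $U$ of $c(t_0)$ there is a neighbourhood $V$ of $t_0$ in $[0,1]$ such that $c(s)\ll_U c(t)$ (respectively $c(s)\le_U c(t)$) for all $s<t$ in $V$; in particular, constant paths are causal. Two timelike (causal) paths from $x$ to $y$ are timelike (causally) homotopic if they are joined by a homotopy with fixed endpoints all of whose intermediate paths are future-directed timelike (causal). Let $\Pi^{\mathrm t}(X)$ be the semicategory (composition is associative, identities are not required) and $\Pi^{\mathrm c}(X)$ the category whose objects are the points of $X$ and whose morphisms from $x$ to $y$ are the timelike, respectively causal, homotopy classes of future-directed timelike, respectively causal, paths from $x$ to $y$, composed by concatenation of paths; the identities of $\Pi^{\mathrm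 c}(X)$ are the classes of the constant paths. **Corollary.** Let $(X,g)$ and $(Y,h)$ be two spacetimes and let $F\colon\Pi^{\mathrm c}(X)\to\Pi^{\mathrm c}(Y)$ be an isomorphism of categories, or $F\colon\Pi^{\mathrm t}(X)\to\Pi^{\mathrm t}(Y)$ an isomorphism of semicategories (i.e. a functor that has an inverse functor). If the object map $f\colon X\to Y$ of $F$ is a ($C^\infty$) diffeomorphism, then $f$ is a conformal diffeomorphism: there is a smooth function $\Omega\colon X\to(0,\infty)$ with $f^*h=\Omega\, g$. -/

import Mathlib

open Set Topology Manifold Bundle CategoryTheory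
open scoped ContDiff unitInterval

/-! ### Smooth Lorentzian metrics and spacetimes -/

section Spacetime

universe u

/-- A smooth Lorentzian metric, of signature `(-, +, …, +)`, on an `n`-dimensional smooth manifold:
a smooth field of symmetric bilinear forms on the tangent spaces each of which is negative on some
vector `v` and positive definite on the orthogonal complement of `v`. -/
structure LorentzianMetric (n : ℕ) (X : Type u) [TopologicalSpace X]
    [ChartedSpace (EuclideanSpace ℝ (Fin n)) X] [IsManifold (𝓡 n) ∞ X] where
  /-- The bilinear form on each tangent space. -/
  inner (x : X) : TangentSpace (𝓡 n) x →L[ℝ] TangentSpace (𝓡 n) x →L[ℝ] ℝ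
  symm (x : X) (v w : TangentSpace (𝓡 n) x) : inner x v w = inner x w v
  signature (x : X) : ∃ v : TangentSpace (𝓡 n) x, inner x v v < 0 ∧
    ∀ w : TangentSpace (𝓡 n) x, inner x v w = 0 → w ≠ 0 → 0 < inner x w w
  contMDiff : ContMDiff (𝓡 n)
    ((𝓡 n).prod 𝓘(ℝ, EuclideanSpace ℝ (Fin n) →L[ℝ] EuclideanSpace ℝ (Fin n) →L[ℝ] ℝ)) ∞
    (fun x ↦ TotalSpace.mk' (EuclideanSpace ℝ (Fin n) →L[ℝ] EuclideanSpace ℝ (Fin n) →L[ℝ] ℝ)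
      (E := fun y : X ↦ TangentSpace (𝓡 n) y →L[ℝ] TangentSpace (𝓡 n) y →L[ℝ] ℝ) x (inner x))

/-- The structure of a smooth spacetime on an `n`-dimensional smooth manifold: a smooth Lorentzian
metric and a time orientation, given by a continuous timelike vector field, which is declared to be
future-directed. -/
structure Spacetime (n : ℕ) (X : Type u) [TopologicalSpace X]
    [ChartedSpace (EuclideanSpace ℝ (Fin n)) X] [IsManifold (𝓡 n) ∞ X] where
  /-- The Lorentzian metric. -/
  metric : LorentzianMetric n X
  /-- The vector field that gives the time orientation. -/
  timeField (x : X) : TangentSpace (𝓡 n) x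
  timeField_continuous : Continuous (fun x ↦ (⟨x, timeField x⟩ : TangentBundle (𝓡 n) X))
  timeField_timelike (x : X) : metric.inner x (timeField x) (timeField x) < 0

/-- The two variants, timelike and causal, of the notions below. -/
inductive CausalType where
  /-- the timelike variant -/
  | timelike
  /-- the causal variant -/
  | causal

namespace Spacetime

variable {n : ℕ} {X : Type u} [TopologicalSpace X]
  [ChartedSpace (EuclideanSpace ℝ (Fin n)) X] [IsManifold (𝓡 n) ∞ X]

/-- `v` is a future-directed timelike, respectively causal (i.e. timelike or lightlike, and
nonzero), tangent vector at `x`. -/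
def IsFutureVector (S : Spacetime n X) (k : CausalType) (x : X) (v : TangentSpace (𝓡 n) x) :
    Prop :=
  match k with
  | .timelike => S.metric.inner x v v < 0 ∧ S.metric.inner x v (S.timeField x) < 0
  | .causal => v ≠ 0 ∧ S.metric.inner x v v ≤ 0 ∧ S.metric.inner x v (S.timeField x) < 0

/-- There is a smooth future-directed timelike (causal) curve `[0,1] → U` from `x` to `y`. -/
def HasSmoothCurve (S : Spacetime n X) (k : CausalType) (U : Set X) (x y : X) : Prop :=
  ∃ γ : ℝ → X, ContMDiffOn 𝓘(ℝ, ℝ) (𝓡 n) ∞ γ (Icc 0 1) ∧ γ 0 = x ∧ γ 1 = y ∧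
    (∀ t ∈ Icc (0 : ℝ) 1, γ t ∈ U) ∧
    ∀ t ∈ Icc (0 : ℝ) 1,
      S.IsFutureVector k (γ t) (mfderivWithin 𝓘(ℝ, ℝ) (𝓡 n) γ (Icc 0 1) t (1 : ℝ))

/-- The chronological relation `x ≪_U y`: some piecewise smooth future-directed timelike curve in
`U` runs from `x` to `y`. The causal relation `x ≤_U y`: either `x = y`, or some piecewise smooth
future-directed causal curve in `U` runs from `x` to `y`. (The points of a chain given by the
transitive closure are the break points of the curve.) -/
def Precedes (S : Spacetime n X) (k : CausalType) (U : Set X) : X → X → Prop :=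
  match k with
  | .timelike => Relation.TransGen (S.HasSmoothCurve .timelike U)
  | .causal => Relation.ReflTransGen (S.HasSmoothCurve .causal U)

/-- A continuous path `c` is future-directed timelike (causal) if locally `c(s) ≪_U c(t)`
(`c(s) ≤_U c(t)`) for `s < t`: for every parameter `t₀` and every open neighbourhood `U` of
`c(t₀)`, this holds for all `s < t` in some neighbourhood of `t₀`. In particular constant paths
are causal. -/
def IsFuturePath (S : Spacetime n X) (k : CausalType) (c : I → X) : Prop :=
  ∀ t₀ : I, ∀ U : Set X, IsOpen U → c t₀ ∈ U →
    ∃ V ∈ 𝓝 t₀, ∀ s ∈ V, ∀ t ∈ V, s < t → S.Precedes k U (c s) (c t)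

/-- The space of continuous future-directed timelike (causal) paths from `x` to `y`. -/
def FuturePath (S : Spacetime n X) (k : CausalType) (x y : X) : Type u :=
  {c : Path x y // S.IsFuturePath k c}

/-- Timelike (causal) homotopy relative to the endpoints: a homotopy with fixed endpoints all of
whose intermediate paths are future-directed timelike (causal). -/
def Homotopic (S : Spacetime n X) (k : CausalType) {x y : X} (p q : Path x y) : Prop :=
  ∃ H : Path.Homotopy p q, ∀ s : I, S.IsFuturePath k (H.eval s)

/-! ### Concatenation of paths and of homotopy classes -/

section Helpers

variable {S : Spacetime n X} {k : CausalType}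

theorem Precedes.trans {U : Set X} {x y z : X} (h₁ : S.Precedes k U x y)
    (h₂ : S.Precedes k U y z) : S.Precedes k U x z := by
  cases k
  · exact Relation.TransGen.trans h₁ h₂
  · exact Relation.ReflTransGen.trans h₁ h₂

theorem isFuturePath_const (x : X) : S.IsFuturePath .causal (fun _ ↦ x) :=
  fun _ _ _ _ ↦ ⟨univ, Filter.univ_mem, fun _ _ _ _ _ ↦ Relation.ReflTransGen.refl⟩

theorem IsFuturePath.comp {c : I → X} (hc : S.IsFuturePath k c) {φ : I → I} (hφ : Continuous φ)
    (hm : Monotone φ) (hs : k = .timelike → StrictMono φ) : S.IsFuturePath k (c ∘ φ) := by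
  intro t₀ U hU h₀
  obtain ⟨V, hV, h⟩ := hc (φ t₀) U hU h₀
  refine ⟨φ ⁻¹' V, hφ.continuousAt hV, fun s hs' t ht hst ↦ ?_⟩
  cases k
  · exact h _ hs' _ ht (hs rfl hst)
  · rcases (hm hst.le).eq_or_lt with he | hlt
    · simp only [Function.comp_apply, he]
      exact Relation.ReflTransGen.refl
    · exact h _ hs' _ ht hlt

theorem isFuturePath_trans {x y z : X} {p : Path x y} {q : Path y z}
    (hp : S.IsFuturePath k p) (hq : S.IsFuturePath k q) : S.IsFuturePath k (p.trans q) := by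
  let α : I → I := fun t ↦ projIcc 0 1 zero_le_one (2 * (t : ℝ))
  let β : I → I := fun t ↦ projIcc 0 1 zero_le_one (2 * (t : ℝ) - 1)
  have hα : Continuous α := continuous_projIcc.comp (by fun_prop)
  have hβ : Continuous β := continuous_projIcc.comp (by fun_prop)
  have eα : ∀ t : I, (t : ℝ) ≤ 1 / 2 → (p.trans q) t = p (α t) := by
    intro t ht
    have h2 : 2 * (t : ℝ) ∈ Icc (0 : ℝ) 1 := ⟨by linarith [t.2.1], by linarith⟩
    rw [Path.trans_apply, dif_pos ht]
    exact congrArg p (projIcc_of_mem zero_le_one h2).symm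
  have eβ : ∀ t : I, 1 / 2 ≤ (t : ℝ) → (p.trans q) t = q (β t) := by
    intro t ht
    have h2 : 2 * (t : ℝ) - 1 ∈ Icc (0 : ℝ) 1 := ⟨by linarith, by linarith [t.2.2]⟩
    rcases ht.eq_or_lt with he | hlt
    · have h3 : (t : ℝ) ≤ 1 / 2 := he.ge
      have e1 : α t = 1 := projIcc_of_right_le _ (by linarith)
      have e2 : β t = 0 := projIcc_of_le_left _ (by linarith)
      rw [eα t h3, e1, e2]
      simp
    · rw [Path.trans_apply, dif_neg (not_le.2 hlt)]
      exact congrArg q (projIcc_of_mem zero_le_one h2).symm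
  have mα : ∀ s t : I, s < t → (t : ℝ) ≤ 1 / 2 → α s < α t := by
    intro s t hst ht
    have hst' : (s : ℝ) < t := hst
    exact strictMonoOn_projIcc zero_le_one (⟨by linarith [s.2.1], by linarith⟩ : _ ∈ Icc (0 : ℝ) 1)
      (⟨by linarith [t.2.1], by linarith⟩ : _ ∈ Icc (0 : ℝ) 1) (by linarith)
  have mβ : ∀ s t : I, s < t → 1 / 2 ≤ (s : ℝ) → β s < β t := by
    intro s t hst hs
    have hst' : (s : ℝ) < t := hst
    exact strictMonoOn_projIcc zero_le_one (⟨by linarith, by linarith [s.2.2]⟩ : _ ∈ Icc (0 : ℝ) 1)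
      (⟨by linarith, by linarith [t.2.2]⟩ : _ ∈ Icc (0 : ℝ) 1) (by linarith)
  have cc : Continuous (fun t : I ↦ (t : ℝ)) := continuous_subtype_val
  intro t₀ U hU h₀
  rcases lt_trichotomy (t₀ : ℝ) (1 / 2) with hlt | he | hgt
  · rw [eα t₀ hlt.le] at h₀
    obtain ⟨V, hV, h⟩ := hp (α t₀) U hU h₀
    refine ⟨α ⁻¹' V ∩ {t | (t : ℝ) < 1 / 2}, Filter.inter_mem (hα.continuousAt hV)
      ((isOpen_Iio.preimage cc).mem_nhds hlt), fun s hs t ht hst ↦ ?_⟩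
    have h1 : (s : ℝ) < 1 / 2 := hs.2
    have h2 : (t : ℝ) < 1 / 2 := ht.2
    rw [eα s h1.le, eα t h2.le]
    exact h _ hs.1 _ ht.1 (mα s t hst h2.le)
  · have hp' := eα t₀ he.le
    have hq' := eβ t₀ he.ge
    obtain ⟨V, hV, h⟩ := hp (α t₀) U hU (hp' ▸ h₀)
    obtain ⟨W, hW, h'⟩ := hq (β t₀) U hU (hq' ▸ h₀)
    refine ⟨α ⁻¹' V ∩ β ⁻¹' W, Filter.inter_mem (hα.continuousAt hV) (hβ.continuousAt hW),
      fun s hs t ht hst ↦ ?_⟩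
    have left : ∀ s t : I, s ∈ α ⁻¹' V → t ∈ α ⁻¹' V → s < t → (t : ℝ) ≤ 1 / 2 →
        S.Precedes k U ((p.trans q) s) ((p.trans q) t) := by
      intro s t hs ht hst h2
      have h1 : (s : ℝ) ≤ 1 / 2 := le_trans (le_of_lt hst) h2
      rw [eα s h1, eα t h2]
      exact h _ hs _ ht (mα s t hst h2)
    have right : ∀ s t : I, s ∈ β ⁻¹' W → t ∈ β ⁻¹' W → s < t → 1 / 2 ≤ (s : ℝ) →
        S.Precedes k U ((p.trans q) s) ((p.trans q) t) := by
      intro s t hs ht hst h1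
      have h2 : 1 / 2 ≤ (t : ℝ) := le_trans h1 (le_of_lt hst)
      rw [eβ s h1, eβ t h2]
      exact h' _ hs _ ht (mβ s t hst h1)
    rcases le_or_gt (t : ℝ) (1 / 2) with h2 | h2
    · exact left s t hs.1 ht.1 hst h2
    · rcases le_or_gt (1 / 2) (s : ℝ) with h1 | h1
      · exact right s t hs.2 ht.2 hst h1
      · have a : s < t₀ := Subtype.coe_lt_coe.1 (he.symm ▸ h1)
        have b : t₀ < t := Subtype.coe_lt_coe.1 (he.symm ▸ h2)
        exact (left s t₀ hs.1 (mem_of_mem_nhds hV : α t₀ ∈ V) a he.le).trans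
          (right t₀ t (mem_of_mem_nhds hW : β t₀ ∈ W) ht.2 b he.ge)
  · rw [eβ t₀ hgt.le] at h₀
    obtain ⟨V, hV, h⟩ := hq (β t₀) U hU h₀
    refine ⟨β ⁻¹' V ∩ {t | 1 / 2 < (t : ℝ)}, Filter.inter_mem (hβ.continuousAt hV)
      ((isOpen_Ioi.preimage cc).mem_nhds hgt), fun s hs t ht hst ↦ ?_⟩
    have h1 : 1 / 2 < (s : ℝ) := hs.2
    have h2 : 1 / 2 < (t : ℝ) := ht.2
    rw [eβ s h1.le, eβ t h2.le]
    exact h _ hs.1 _ ht.1 (mβ s t hst h1.le)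

theorem Homotopic.refl {x y : X} {p : Path x y} (hp : S.IsFuturePath k p) : S.Homotopic k p p :=
  ⟨Path.Homotopy.refl p, fun _ ↦ hp⟩

theorem Homotopic.symm {x y : X} {p q : Path x y} (h : S.Homotopic k p q) :
    S.Homotopic k q p := by
  obtain ⟨H, hH⟩ := h
  refine ⟨H.symm, fun s ↦ ?_⟩
  have e : H.symm.eval s = H.eval (unitInterval.symm s) := by
    ext t
    exact ContinuousMap.HomotopyWith.symm_apply H (s, t)
  rw [e]
  exact hH _

theorem Homotopic.trans {x y : X} {p q r : Path x y} (h₁ : S.Homotopic k p q)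
    (h₂ : S.Homotopic k q r) : S.Homotopic k p r := by
  obtain ⟨H, hH⟩ := h₁
  obtain ⟨G, hG⟩ := h₂
  refine ⟨H.trans G, fun s ↦ ?_⟩
  by_cases hs : (s : ℝ) ≤ 1 / 2
  · convert hH ⟨2 * s, (unitInterval.mul_pos_mem_iff zero_lt_two).2 ⟨s.2.1, hs⟩⟩ using 1
    ext t
    exact (Path.Homotopy.trans_apply H G (s, t)).trans (dif_pos hs)
  · convert hG ⟨2 * s - 1, unitInterval.two_mul_sub_one_mem_iff.2 ⟨(not_le.1 hs).le, s.2.2⟩⟩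
      using 1
    ext t
    exact (Path.Homotopy.trans_apply H G (s, t)).trans (dif_neg hs)

theorem Homotopic.hcomp {x y z : X} {p₀ p₁ : Path x y} {q₀ q₁ : Path y z}
    (h₁ : S.Homotopic k p₀ p₁) (h₂ : S.Homotopic k q₀ q₁) :
    S.Homotopic k (p₀.trans q₀) (p₁.trans q₁) := by
  obtain ⟨H, hH⟩ := h₁
  obtain ⟨G, hG⟩ := h₂
  exact ⟨H.hcomp G, fun s ↦ isFuturePath_trans (hH s) (hG s)⟩

theorem Homotopic.reparam {x y : X} {p : Path x y} (hp : S.IsFuturePath k p) {φ : I → I}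
    (hφ : Continuous φ) (h₀ : φ 0 = 0) (h₁ : φ 1 = 1) (hm : Monotone φ)
    (hs : k = .timelike → StrictMono φ) : S.Homotopic k p (p.reparam φ hφ h₀ h₁) := by
  refine ⟨Path.Homotopy.reparam p φ hφ h₀ h₁, fun s ↦ ?_⟩
  let ψ : I → I := fun t ↦ ⟨unitInterval.symm s * t + s * φ t,
    show (unitInterval.symm s : ℝ) • (t : ℝ) + (s : ℝ) • (φ t : ℝ) ∈ I from
      convex_Icc _ _ t.2 (φ t).2 (by unit_interval) (by unit_interval) (by simp)⟩
  have e0 : 0 ≤ (s : ℝ) := s.2.1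
  have e1 : 0 ≤ 1 - (s : ℝ) := by linarith [s.2.2]
  have hψ : Continuous ψ := by fun_prop
  refine IsFuturePath.comp (φ := ψ) hp hψ (fun a b hab ↦ ?_) (fun hk a b hab ↦ ?_)
  · have h1 : (a : ℝ) ≤ b := hab
    have h2 : (φ a : ℝ) ≤ φ b := hm hab
    change (1 - (s : ℝ)) * a + s * φ a ≤ (1 - (s : ℝ)) * b + s * φ b
    gcongr
  · have h1 : (a : ℝ) < b := hab
    have h2 : (φ a : ℝ) < φ b := hs hk hab
    change (1 - (s : ℝ)) * a + s * φ a < (1 - (s : ℝ)) * b + s * φ b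
    rcases e0.eq_or_lt with h | h
    · rw [← h]; linarith
    · exact add_lt_add_of_le_of_lt (mul_le_mul_of_nonneg_left h1.le e1)
        (mul_lt_mul_of_pos_left h2 h)

theorem Homotopic.trans_assoc {x y z w : X} {p : Path x y} {q : Path y z} {r : Path z w}
    (hp : S.IsFuturePath k p) (hq : S.IsFuturePath k q) (hr : S.IsFuturePath k r) :
    S.Homotopic k ((p.trans q).trans r) (p.trans (q.trans r)) := by
  have hs : StrictMono (fun t : I ↦ (⟨Path.Homotopy.transAssocReparamAux t,
      Path.Homotopy.transAssocReparamAux_mem_I t⟩ : I)) := by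
    intro a b hab
    have h1 : (a : ℝ) < b := hab
    change Path.Homotopy.transAssocReparamAux a < Path.Homotopy.transAssocReparamAux b
    unfold Path.Homotopy.transAssocReparamAux
    split_ifs <;> linarith
  rw [Path.Homotopy.trans_assoc_reparam]
  exact (Homotopic.reparam (isFuturePath_trans hp (isFuturePath_trans hq hr)) _ _ _
    hs.monotone (fun _ ↦ hs)).symm

theorem Homotopic.trans_refl {x y : X} {p : Path x y} (hp : S.IsFuturePath .causal p) :
    S.Homotopic .causal (p.trans (Path.refl y)) p := by
  rw [Path.Homotopy.trans_refl_reparam]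
  refine (Homotopic.reparam hp _ _ _ (fun a b hab ↦ ?_) (fun h ↦ nomatch h)).symm
  have h1 : (a : ℝ) ≤ b := hab
  change Path.Homotopy.transReflReparamAux a ≤ Path.Homotopy.transReflReparamAux b
  unfold Path.Homotopy.transReflReparamAux
  split_ifs <;> linarith

theorem Homotopic.refl_trans {x y : X} {p : Path x y} (hp : S.IsFuturePath .causal p) :
    S.Homotopic .causal ((Path.refl x).trans p) p := by
  have hφ : Continuous (fun t : I ↦ projIcc (0 : ℝ) 1 zero_le_one (2 * (t : ℝ) - 1)) :=
    continuous_projIcc.comp (by fun_prop)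
  have h₀ : projIcc (0 : ℝ) 1 zero_le_one (2 * ((0 : I) : ℝ) - 1) = 0 :=
    projIcc_of_le_left _ (by norm_num)
  have h₁ : projIcc (0 : ℝ) 1 zero_le_one (2 * ((1 : I) : ℝ) - 1) = 1 :=
    projIcc_of_right_le _ (by norm_num)
  have he : (Path.refl x).trans p = p.reparam _ hφ h₀ h₁ := by
    ext t
    rw [Path.trans_apply]
    split_ifs with h
    · have : projIcc (0 : ℝ) 1 zero_le_one (2 * (t : ℝ) - 1) = 0 :=
        projIcc_of_le_left _ (by linarith)
      simp [this]
    · have h2 : 2 * (t : ℝ) - 1 ∈ Icc (0 : ℝ) 1 := ⟨by linarith, by linarith [t.2.2]⟩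
      exact congrArg p (projIcc_of_mem zero_le_one h2).symm
  rw [he]
  refine (Homotopic.reparam hp hφ h₀ h₁ (fun a b hab ↦ ?_) (fun h ↦ nomatch h)).symm
  have h1 : (a : ℝ) ≤ b := hab
  exact monotone_projIcc _ (by linarith)

end Helpers

/-- The equivalence relation of timelike (causal) homotopy. -/
@[reducible]
def homotopySetoid (S : Spacetime n X) (k : CausalType) (x y : X) :
    Setoid (S.FuturePath k x y) where
  r p q := S.Homotopic k p.1 q.1
  iseqv := ⟨fun p ↦ Homotopic.refl p.2, Homotopic.symm, Homotopic.trans⟩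

/-- The set of timelike (causal) homotopy classes of future-directed timelike (causal) paths from
`x` to `y`. -/
def HomotopyClass (S : Spacetime n X) (k : CausalType) (x y : X) : Type u :=
  Quotient (S.homotopySetoid k x y)

/-- The class of the concatenation of two paths, first `a` and then `b`. -/
noncomputable def HomotopyClass.comp {S : Spacetime n X} {k : CausalType} {x y z : X} :
    S.HomotopyClass k x y → S.HomotopyClass k y z → S.HomotopyClass k x z :=
  Quotient.map₂ (sa := S.homotopySetoid k x y) (sb := S.homotopySetoid k y z)
    (sc := S.homotopySetoid k x z) (fun a b ↦ ⟨a.1.trans b.1, isFuturePath_trans a.2 b.2⟩)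
    (fun _ _ h₁ _ _ h₂ ↦ Homotopic.hcomp h₁ h₂)

theorem HomotopyClass.comp_assoc {S : Spacetime n X} {k : CausalType} {x y z w : X}
    (a : S.HomotopyClass k x y) (b : S.HomotopyClass k y z) (c : S.HomotopyClass k z w) :
    (a.comp b).comp c = a.comp (b.comp c) := by
  obtain ⟨a⟩ := a
  obtain ⟨b⟩ := b
  obtain ⟨c⟩ := c
  exact Quotient.sound (s := S.homotopySetoid k x w) (Homotopic.trans_assoc a.2 b.2 c.2)

end Spacetime

end Spacetime

/-! ### Semicategories -/

section Semicategory

universe v₁ v₂ v₃ u₁ u₂ u₃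

/-- A semicategory: objects, morphisms and an associative composition. -/
class Semicategory (C : Type u₁) where
  /-- The morphisms. -/
  Hom : C → C → Type v₁
  /-- The composition, in diagrammatic order. -/
  comp {x y z : C} : Hom x y → Hom y z → Hom x z
  assoc {x y z w : C} (a : Hom x y) (b : Hom y z) (c : Hom z w) :
    comp (comp a b) c = comp a (comp b c)

/-- A functor between semicategories. -/
structure Semifunctor (C : Type u₁) [Semicategory.{v₁} C] (D : Type u₂) [Semicategory.{v₂} D] where
  /-- The object map. -/
  obj : C → D
  /-- The morphism map. -/
  map {x y : C} : Semicategory.Hom x y → Semicategory.Hom (obj x) (obj y)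
  map_comp {x y z : C} (a : Semicategory.Hom x y) (b : Semicategory.Hom y z) :
    map (Semicategory.comp a b) = Semicategory.comp (map a) (map b)

namespace Semifunctor

/-- The identity functor of a semicategory. -/
def id (C : Type u₁) [Semicategory.{v₁} C] : Semifunctor C C where
  obj x := x
  map a := a
  map_comp _ _ := rfl

/-- The composite of two functors of semicategories, first `F` and then `G`. -/
def comp {C : Type u₁} [Semicategory.{v₁} C] {D : Type u₂} [Semicategory.{v₂} D]
    {E : Type u₃} [Semicategory.{v₃} E] (F : Semifunctor C D) (G : Semifunctor D E) :
    Semifunctor C E where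
  obj x := G.obj (F.obj x)
  map a := G.map (F.map a)
  map_comp a b := by rw [F.map_comp, G.map_comp]

/-- `F` is an isomorphism of semicategories: it has an inverse functor. -/
def IsIsomorphism {C : Type u₁} [Semicategory.{v₁} C] {D : Type u₂} [Semicategory.{v₂} D]
    (F : Semifunctor C D) : Prop :=
  ∃ G : Semifunctor D C, F.comp G = Semifunctor.id C ∧ G.comp F = Semifunctor.id D

end Semifunctor

/-- `F` is an isomorphism of categories: it has an inverse functor. -/
def CategoryTheory.Functor.IsIsomorphism {C : Type u₁} [Category.{v₁} C] {D : Type u₂}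
    [Category.{v₂} D] (F : C ⥤ D) : Prop :=
  ∃ G : D ⥤ C, F ⋙ G = 𝟭 C ∧ G ⋙ F = 𝟭 D

end Semicategory

/-! ### The timelike semicategory, the causal category, and conformal maps -/

section HomotopyCategories

universe u v

variable {n : ℕ} {X : Type u} [TopologicalSpace X]
  [ChartedSpace (EuclideanSpace ℝ (Fin n)) X] [IsManifold (𝓡 n) ∞ X]

/-- The objects of the timelike semicategory of a spacetime: its points. -/
structure TimelikeSemicategory (S : Spacetime n X) : Type u where
  /-- The underlying point. -/
  pt : X

/-- The objects of the causal category of a spacetime: its points. -/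
structure CausalCategory (S : Spacetime n X) : Type u where
  /-- The underlying point. -/
  pt : X

noncomputable instance TimelikeSemicategory.semicategory (S : Spacetime n X) :
    Semicategory.{u} (TimelikeSemicategory S) where
  Hom x y := S.HomotopyClass .timelike x.pt y.pt
  comp a b := a.comp b
  assoc := Spacetime.HomotopyClass.comp_assoc

noncomputable instance CausalCategory.category (S : Spacetime n X) : Category.{u} (CausalCategory S) where
  Hom x y := S.HomotopyClass .causal x.pt y.pt
  id x := Quotient.mk (S.homotopySetoid .causal x.pt x.pt)
    ⟨Path.refl x.pt, Spacetime.isFuturePath_const x.pt⟩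
  comp a b := a.comp b
  id_comp {x y} a := by
    obtain ⟨a⟩ := a
    exact Quotient.sound (s := S.homotopySetoid .causal x.pt y.pt)
      (Spacetime.Homotopic.refl_trans a.2)
  comp_id {x y} a := by
    obtain ⟨a⟩ := a
    exact Quotient.sound (s := S.homotopySetoid .causal x.pt y.pt)
      (Spacetime.Homotopic.trans_refl a.2)
  assoc := Spacetime.HomotopyClass.comp_assoc

/-- The diffeomorphism `f` from `(X, g)` to `(Y, h)` is conformal: `f^* h = Ω g` for some smooth
function `Ω : X → (0, ∞)`. -/
def IsConformalDiffeomorph {m : ℕ} {Y : Type v} [TopologicalSpace Y]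
    [ChartedSpace (EuclideanSpace ℝ (Fin m)) Y] [IsManifold (𝓡 m) ∞ Y]
    (g : LorentzianMetric n X) (h : LorentzianMetric m Y) (f : X ≃ₘ⟮𝓡 n, 𝓡 m⟯ Y) : Prop :=
  ∃ Ω : X → ℝ, ContMDiff (𝓡 n) 𝓘(ℝ, ℝ) ∞ Ω ∧ (∀ x, 0 < Ω x) ∧
    ∀ (x : X) (v w : TangentSpace (𝓡 n) x),
      h.inner (f x) (mfderiv (𝓡 n) (𝓡 m) f x v) (mfderiv (𝓡 n) (𝓡 m) f x w) =
        Ω x * g.inner x v w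

end HomotopyCategories

/-! Composition in these categories records which points a homotopy class can pass through. A class
that factors through `z` contains a path through `z`, and a path that passes through `z` at an
interior parameter gives such a factorization. An isomorphism and its inverse both preserve
factorizations.

This becomes infinitesimal information because short paths are confined, even if the spacetime has
closed causal curves. Near `p`, all future causal vectors lie in one closed convex cone `‖a‖ ≤ K * ℓ
a` of chart coordinates (`Spacetime.exists_cone_bound`). A future path inside a small chart ball is
therefore monotone for the order of this cone, and its endpoints bound its distance from `p`. If the
endpoints are close, an open-closed argument keeps the whole homotopy in the ball
(`ConeBound.homotopic_mem_chartBall`).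

Let `γ` be a short curve from `p` with future timelike initial velocity `v`. The functor sends its
class to the class of some path `d` in `Y`. Every interior point of `d` corresponds under `f⁻¹` to a
point on a path homotopic to `γ`, so `d` stays near `f p`. There the linear form `-⟨u, ·⟩`, for a
future timelike `u`, does not decrease along future paths. Differentiating along `f ∘ γ` at `0`
gives `⟨u, df v⟩ ≤ 0` for all such `u`, so `df v` lies in the dual of the future cone and is not
spacelike.

The same holds for `f⁻¹`. Every null vector of `g` is a limit both of timelike and of spacelike
vectors (or zero), so `f^* h` vanishes on it. A symmetric form that vanishes on the null cone of a
Lorentzian form is a multiple of it (`IsLorentzForm.exists_eq_smul`). -/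

/-! ### Linear algebra of Lorentzian bilinear forms -/

section LorentzForm

variable {V : Type*} [AddCommGroup V] [Module ℝ V]

/-- A symmetric bilinear form of signature `(-, +, …, +)`. -/
structure IsLorentzForm (B : LinearMap.BilinForm ℝ V) : Prop where
  symm (v w : V) : B v w = B w v
  signature : ∃ v : V, B v v < 0 ∧ ∀ w : V, B v w = 0 → w ≠ 0 → 0 < B w w

namespace IsLorentzForm

variable {B : LinearMap.BilinForm ℝ V}

/-- The orthogonal complement of every timelike vector is positive definite. -/
theorem pos_of_orthogonal (hB : IsLorentzForm B) {t w : V} (ht : B t t < 0) (htw : B t w = 0)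
    (hw : w ≠ 0) : 0 < B w w := by
  obtain ⟨v, hv, hpos⟩ := hB.signature
  by_contra! hneg
  -- This combination is orthogonal to `v`, but its square `(B v w)² B t t + (B v t)² B w w` is not
  -- positive.
  have hz : B v w • t - B v t • w = 0 := by
    by_contra hz
    have h1 := hpos _ (by simp; ring) hz
    have h2 := hB.symm w t
    simp only [map_sub, map_smul, LinearMap.sub_apply, LinearMap.smul_apply, smul_eq_mul, h2,
      htw] at h1
    nlinarith [mul_nonneg (sq_nonneg (B v w)) (neg_nonneg.2 ht.le),
      mul_nonneg (sq_nonneg (B v t)) (neg_nonneg.2 hneg)]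
  have h3 : B v w = 0 := by
    have := congrArg (B t) hz
    simp only [map_sub, map_smul, smul_eq_mul, htw, map_zero, mul_zero, sub_zero] at this
    exact (mul_eq_zero.1 this).resolve_right ht.ne
  exact absurd (hpos w h3 hw) (not_lt.2 hneg)

theorem ne_zero_of_causal (hB : IsLorentzForm B) {t v : V} (ht : B t t < 0) (hv : B v v ≤ 0)
    (hv0 : v ≠ 0) : B v t ≠ 0 := fun h ↦
  absurd (hB.pos_of_orthogonal ht (by rw [hB.symm, h]) hv0) (not_lt.2 hv)

/-- The reversed Cauchy–Schwarz inequality, as a statement on time orientations. -/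
theorem neg_of_future (hB : IsLorentzForm B) {t u w : V} (ht : B t t < 0) (hu : B u u < 0)
    (hut : B u t < 0) (hw : B w w ≤ 0) (hwt : B w t < 0) : B w u < 0 := by
  by_contra! h
  -- If `B w u ≥ 0`, this combination is a timelike vector orthogonal to the timelike vector `t`.
  have hz0 : B (B w t • u - B u t • w) (B w t • u - B u t • w) < 0 := by
    have h2 := hB.symm u w
    simp only [map_sub, map_smul, LinearMap.sub_apply, LinearMap.smul_apply, smul_eq_mul, h2]
    nlinarith [mul_pos (mul_pos_of_neg_of_neg hwt hwt) (neg_pos.2 hu),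
      mul_nonneg (mul_pos_of_neg_of_neg hut hut).le (neg_nonneg.2 hw),
      mul_nonneg (mul_pos_of_neg_of_neg hut hwt).le h]
  have hz : B t (B w t • u - B u t • w) = 0 := by
    simp only [map_sub, map_smul, smul_eq_mul, hB.symm t u, hB.symm t w]
    ring
  refine absurd (hB.pos_of_orthogonal ht hz ?_) (not_lt.2 hz0.le)
  rintro h0
  simp [h0] at hz0

/-- A vector in the dual of the future cone is causal. -/
theorem nonpos_of_dual {t w : V} (ht : B t t < 0) (hB : IsLorentzForm B)
    (hdual : ∀ u, B u u < 0 → B u t < 0 → B w u ≤ 0) : B w w ≤ 0 := by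
  by_contra! hq
  have hp : B w t ≤ 0 := hdual t ht ht
  -- A spacelike `w` is tested against `u = w + s • t`. The conditions say that `B w u > 0` and that
  -- `u` is timelike; `u` is future-directed because `B w t ≤ 0`.
  suffices ∃ s : ℝ, 0 < s ∧ 0 < B w w + s * B w t ∧ B w w + 2 * s * B w t + s ^ 2 * B t t < 0 by
    obtain ⟨s, hs, h1, h2⟩ := this
    have h3 := hdual (w + s • t) ?_ ?_
    · simp only [map_add, map_smul, smul_eq_mul] at h3
      linarith
    · simp only [map_add, map_smul, LinearMap.add_apply, LinearMap.smul_apply, smul_eq_mul,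
        hB.symm t w]
      linarith
    · simp only [map_add, map_smul, LinearMap.add_apply, LinearMap.smul_apply, smul_eq_mul]
      nlinarith
  rcases hp.lt_or_eq with hp | hp
  · have hne := hp.ne
    -- Any factor between `1/2` and `1` would do in place of `3/4`: `s * B w t` must exceed `-B w
    -- w`, and twice it must be below `-B w w`.
    refine ⟨-(3 / 4 * B w w / B w t), ?_, ?_, ?_⟩
    · rw [Left.neg_pos_iff]
      exact div_neg_of_pos_of_neg (by positivity) hp
    · have : -(3 / 4 * B w w / B w t) * B w t = -(3 / 4 * B w w) := by
        field_simp
      linarith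
    · have : -(3 / 4 * B w w / B w t) * B w t = -(3 / 4 * B w w) := by
        field_simp
      nlinarith [mul_nonneg (sq_nonneg (-(3 / 4 * B w w / B w t))) (neg_nonneg.2 ht.le)]
  · have hc : 0 < -B t t := neg_pos.2 ht
    refine ⟨1 + B w w / -B t t, by positivity, by rw [hp]; linarith, ?_⟩
    have h4 : (1 + B w w / -B t t) * -B t t = -B t t + B w w := by
      rw [add_mul, div_mul_cancel₀ _ hc.ne', one_mul]
    have h5 : 0 < B w w / -B t t := by positivity
    rw [hp]
    nlinarith [mul_pos h5 hq, mul_pos h5 hc]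

/-- A symmetric bilinear form whose sign is controlled by the Lorentzian form `B` as in the
hypotheses is a multiple of `B`. -/
theorem exists_eq_smul (hB : IsLorentzForm B) {b : LinearMap.BilinForm ℝ V}
    (hb : ∀ v w, b v w = b w v) (h₁ : ∀ v, B v v < 0 → b v v ≤ 0)
    (h₂ : ∀ v, b v v < 0 → B v v ≤ 0) {t : V} (ht : B t t < 0) :
    ∀ v w, B t t * b v w = b t t * B v w := by
  -- The vector `t + e` is null. Adding `s • t` makes it timelike, so `h₁` applies; adding `s • e`
  -- makes it spacelike, so the contrapositive of `h₂` applies. The limits `s → 0` give both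
  -- inequalities.
  have null_pert : ∀ e : V, B t e = 0 → B e e = -B t t →
      b (t + e) (t + e) = 0 := by
    intro e hte hee
    have het : B e t = 0 := by rw [hB.symm, hte]
    have lim : Filter.Tendsto (fun s : ℝ ↦ b (t + e + s • e) (t + e + s • e))
        (𝓝[>] 0) (𝓝 (b (t + e) (t + e))) := by
      have : Continuous (fun s : ℝ ↦ b (t + e + s • e) (t + e + s • e)) := by
        simp only [map_add, map_smul, LinearMap.add_apply, LinearMap.smul_apply, smul_eq_mul]
        fun_prop
      have h := this.tendsto 0
      simp only [zero_smul, add_zero] at h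
      exact h.mono_left nhdsWithin_le_nhds
    have lim' : Filter.Tendsto (fun s : ℝ ↦ b (t + e + s • t) (t + e + s • t))
        (𝓝[>] 0) (𝓝 (b (t + e) (t + e))) := by
      have : Continuous (fun s : ℝ ↦ b (t + e + s • t) (t + e + s • t)) := by
        simp only [map_add, map_smul, LinearMap.add_apply, LinearMap.smul_apply, smul_eq_mul]
        fun_prop
      have h := this.tendsto 0
      simp only [zero_smul, add_zero] at h
      exact h.mono_left nhdsWithin_le_nhds
    apply le_antisymm
    · refine le_of_tendsto lim' ?_
      filter_upwards [self_mem_nhdsWithin] with s hs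
      have hs : 0 < s := hs
      refine h₁ _ ?_
      simp only [map_add, map_smul, LinearMap.add_apply, LinearMap.smul_apply, smul_eq_mul,
        hte, het, hee]
      nlinarith [mul_pos hs (neg_pos.2 ht), mul_pos (mul_pos hs hs) (neg_pos.2 ht)]
    · refine ge_of_tendsto (lim) ?_
      filter_upwards [self_mem_nhdsWithin] with s hs
      have hs : 0 < s := hs
      by_contra! hneg
      have := h₂ _ hneg
      simp only [map_add, map_smul, LinearMap.add_apply, LinearMap.smul_apply, smul_eq_mul,
        hte, het, hee] at this
      nlinarith [mul_pos hs (neg_pos.2 ht), mul_pos (mul_pos hs hs) (neg_pos.2 ht)]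
  -- Rescale `e` so that `t ± r • e` are both null. The difference of the two equations gives `b t e
  -- = 0`, and their sum relates `b t t` to `b e e`.
  have orth : ∀ e : V, B t e = 0 → b t e = 0 ∧ B t t * b e e = b t t * B e e := by
    intro e hte
    rcases eq_or_ne e 0 with rfl | he
    · simp
    have hpos := hB.pos_of_orthogonal ht hte he
    set r : ℝ := √(-B t t / B e e) with hr
    have hr2 : r * r * B e e = -B t t := by
      rw [hr, Real.mul_self_sqrt (div_nonneg (neg_pos.2 ht).le hpos.le),
        div_mul_cancel₀ _ hpos.ne']
    have hr0 : r ≠ 0 := by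
      rintro h
      rw [h] at hr2
      linarith
    have p1 := null_pert (r • e) (by simp [hte]) (by simp [← hr2, mul_assoc])
    have p2 := null_pert (-(r • e)) (by simp [hte]) (by simp [← hr2, mul_assoc])
    simp only [map_add, map_neg, map_smul, LinearMap.add_apply, LinearMap.neg_apply,
      LinearMap.smul_apply, smul_eq_mul, hb e t] at p1 p2
    refine ⟨?_, ?_⟩
    · have : r * b t e = 0 := by linarith
      exact (mul_eq_zero.1 this).resolve_left hr0
    · have h1 : b t t = -(r * r * b e e) := by linarith
      have h2 : B t t = -(r * r * B e e) := by linarith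
      rw [h1, h2]
      ring
  have diag : ∀ v, B t t * b v v = b t t * B v v := by
    intro v
    set a : ℝ := B t v / B t t with ha
    have hv : v = a • t + (v - a • t) := by abel
    have hte : B t (v - a • t) = 0 := by
      simp [ha, ht.ne]
    generalize v - a • t = e at hv hte
    obtain ⟨o1, o2⟩ := orth e hte
    rw [hv]
    simp only [map_add, map_smul, LinearMap.add_apply, LinearMap.smul_apply, smul_eq_mul,
      hb e t, hB.symm e t, hte, o1]
    linear_combination o2
  intro v w
  have h := diag (v + w)
  simp only [map_add, LinearMap.add_apply, hb w v, hB.symm w v] at h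
  linear_combination (h - diag v - diag w) / 2

end IsLorentzForm

end LorentzForm

/-! ### The metric on the tangent bundle -/

section Cone

universe u

variable {n : ℕ} {X : Type u} [TopologicalSpace X]
  [ChartedSpace (EuclideanSpace ℝ (Fin n)) X] [IsManifold (𝓡 n) ∞ X]

/-- The metric at a point, as a bilinear form. -/
noncomputable def LorentzianMetric.form (g : LorentzianMetric n X) (x : X) :
    LinearMap.BilinForm ℝ (TangentSpace (𝓡 n) x) :=
  LinearMap.mk₂ ℝ (fun v w ↦ g.inner x v w) (fun v v' w ↦ by simp) (fun c v w ↦ by simp)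
    (fun v w w' ↦ by simp) (fun c v w ↦ by simp)

@[simp]
theorem LorentzianMetric.form_apply (g : LorentzianMetric n X) (x : X)
    (v w : TangentSpace (𝓡 n) x) : g.form x v w = g.inner x v w := rfl

theorem LorentzianMetric.isLorentzForm (g : LorentzianMetric n X) (x : X) :
    IsLorentzForm (g.form x) where
  symm := g.symm x
  signature := g.signature x

theorem LorentzianMetric.contMDiff_quadratic (g : LorentzianMetric n X) :
    ContMDiff (𝓡 n).tangent 𝓘(ℝ, ℝ) ∞
      (fun V : TangentBundle (𝓡 n) X ↦ g.inner V.1 V.2 V.2) := by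
  -- Scalars are viewed as points of the trivial line bundle, where evaluation of a bundle of
  -- bilinear maps is smooth.
  have : ContMDiff (𝓡 n).tangent ((𝓡 n).prod 𝓘(ℝ)) ∞
      (fun V : TangentBundle (𝓡 n) X ↦
        TotalSpace.mk' ℝ (E := Bundle.Trivial X ℝ) V.1 (g.inner V.1 V.2 V.2)) := by
    apply ContMDiff.clm_bundle_apply₂ (F₁ := EuclideanSpace ℝ (Fin n))
      (F₂ := EuclideanSpace ℝ (Fin n)) (b := fun V : TangentBundle (𝓡 n) X ↦ V.1)
    · exact g.contMDiff.comp (contMDiff_proj (TangentSpace (𝓡 n)))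
    · exact contMDiff_id
    · exact contMDiff_id
  exact fun V ↦ (contMDiffAt_totalSpace.1 (this V)).2

theorem LorentzianMetric.continuous_inner (g : LorentzianMetric n X) {W : Type*}
    [TopologicalSpace W] {b : W → X} {v w : ∀ a, TangentSpace (𝓡 n) (b a)} {s : Set W} {a : W}
    (hv : ContinuousWithinAt (fun a ↦ (⟨b a, v a⟩ : TangentBundle (𝓡 n) X)) s a)
    (hw : ContinuousWithinAt (fun a ↦ (⟨b a, w a⟩ : TangentBundle (𝓡 n) X)) s a) :
    ContinuousWithinAt (fun a ↦ g.inner (b a) (v a) (w a)) s a := by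
  have hb : ContinuousWithinAt b s a :=
    (FiberBundle.continuous_proj _ (TangentSpace (𝓡 n))).continuousAt.comp_continuousWithinAt hv
  have : ContinuousWithinAt (fun a ↦
        TotalSpace.mk' ℝ (E := Bundle.Trivial X ℝ) (b a) (g.inner (b a) (v a) (w a))) s a := by
    apply ContinuousWithinAt.clm_bundle_apply₂ (F₁ := EuclideanSpace ℝ (Fin n))
      (F₂ := EuclideanSpace ℝ (Fin n)) (b := b)
    · exact g.contMDiff.continuous.continuousAt.comp_continuousWithinAt hb
    · exact hv
    · exact hw
  exact ((FiberBundle.continuousWithinAt_totalSpace _ _).1 this).2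

/-- The tangent vector at `q` whose coordinates in the chart at `p` are `a`. -/
noncomputable def vectorOfCoord (p q : X) (a : EuclideanSpace ℝ (Fin n)) :
    TangentSpace (𝓡 n) q :=
  (trivializationAt (EuclideanSpace ℝ (Fin n)) (TangentSpace (𝓡 n) (M := X)) p).symmL ℝ q a

/-- The coordinates of a tangent vector at `q` in the chart at `p`. -/
noncomputable def coordOfVector (p q : X) :
    TangentSpace (𝓡 n) q →L[ℝ] EuclideanSpace ℝ (Fin n) :=
  (trivializationAt (EuclideanSpace ℝ (Fin n)) (TangentSpace (𝓡 n) (M := X))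
    p).continuousLinearMapAt ℝ q

theorem mk_vectorOfCoord {p q : X} (hq : q ∈ (chartAt (EuclideanSpace ℝ (Fin n)) p).source)
    (a : EuclideanSpace ℝ (Fin n)) :
    (⟨q, vectorOfCoord p q a⟩ : TangentBundle (𝓡 n) X) =
      (trivializationAt (EuclideanSpace ℝ (Fin n)) (TangentSpace (𝓡 n) (M := X))
        p).toOpenPartialHomeomorph.symm (q, a) := by
  rw [vectorOfCoord, Trivialization.symmL_apply _ hq]
  exact Trivialization.mk_symm _ hq a

theorem continuousAt_vectorOfCoord {p q : X} (hq : q ∈ (chartAt (EuclideanSpace ℝ (Fin n)) p).source)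
    (a : EuclideanSpace ℝ (Fin n)) :
    ContinuousAt (fun z : X × EuclideanSpace ℝ (Fin n) ↦
      (⟨z.1, vectorOfCoord p z.1 z.2⟩ : TangentBundle (𝓡 n) X)) (q, a) := by
  have h2 : (q, a) ∈ (trivializationAt (EuclideanSpace ℝ (Fin n))
      (TangentSpace (𝓡 n) (M := X)) p).target :=
    (Trivialization.mem_target _).2 hq
  refine ((trivializationAt (EuclideanSpace ℝ (Fin n)) (TangentSpace (𝓡 n) (M := X))
    p).toOpenPartialHomeomorph.continuousAt_symm h2).congr ?_
  have h3 := (continuousAt_fst (p := (q, a))).preimage_mem_nhds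
    ((chartAt (EuclideanSpace ℝ (Fin n)) p).open_source.mem_nhds hq)
  filter_upwards [h3] with z hz
  exact (mk_vectorOfCoord hz z.2).symm

theorem contMDiffAt_vectorOfCoord {p q : X}
    (hq : q ∈ (chartAt (EuclideanSpace ℝ (Fin n)) p).source) (a : EuclideanSpace ℝ (Fin n)) :
    ContMDiffAt (𝓡 n) (𝓡 n).tangent ∞
      (fun z : X ↦ (⟨z, vectorOfCoord p z a⟩ : TangentBundle (𝓡 n) X)) q := by
  have h := (Trivialization.contMDiffOn_symm (n := ∞) (IB := 𝓡 n)
    (trivializationAt (EuclideanSpace ℝ (Fin n)) (TangentSpace (𝓡 n) (M := X)) p))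
  have h2 : (q, a) ∈ (trivializationAt (EuclideanSpace ℝ (Fin n))
      (TangentSpace (𝓡 n) (M := X)) p).target :=
    (Trivialization.mem_target _).2 hq
  have h3 := (h (q, a) h2).contMDiffAt ((trivializationAt (EuclideanSpace ℝ (Fin n))
      (TangentSpace (𝓡 n) (M := X)) p).open_target.mem_nhds h2)
  have h4 : ContMDiffAt (𝓡 n) ((𝓡 n).prod 𝓘(ℝ, EuclideanSpace ℝ (Fin n))) ∞
      (fun z : X ↦ (z, a)) q := contMDiffAt_id.prodMk contMDiffAt_const
  refine (ContMDiffAt.comp q h3 h4).congr_of_eventuallyEq ?_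
  filter_upwards [(chartAt (EuclideanSpace ℝ (Fin n)) p).open_source.mem_nhds hq] with z hz
  exact mk_vectorOfCoord hz a

theorem coordOfVector_vectorOfCoord {p q : X}
    (hq : q ∈ (chartAt (EuclideanSpace ℝ (Fin n)) p).source) (a : EuclideanSpace ℝ (Fin n)) :
    coordOfVector p q (vectorOfCoord p q a) = a :=
  (trivializationAt (EuclideanSpace ℝ (Fin n)) (TangentSpace (𝓡 n) (M := X))
    p).continuousLinearMapAt_symmL (R := ℝ) hq a

theorem vectorOfCoord_coordOfVector {p q : X}
    (hq : q ∈ (chartAt (EuclideanSpace ℝ (Fin n)) p).source) (v : TangentSpace (𝓡 n) q) :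
    vectorOfCoord p q (coordOfVector p q v) = v :=
  (trivializationAt (EuclideanSpace ℝ (Fin n)) (TangentSpace (𝓡 n) (M := X))
    p).symmL_continuousLinearMapAt (R := ℝ) hq v

/-- Identifies bundle coordinates with the derivative of the chart, so that velocities of curves can
be computed in the chart. -/
theorem coordOfVector_eq_mfderiv {p q : X}
    (hq : q ∈ (chartAt (EuclideanSpace ℝ (Fin n)) p).source) (v : TangentSpace (𝓡 n) q) :
    coordOfVector p q v =
      mfderiv (𝓡 n) 𝓘(ℝ, EuclideanSpace ℝ (Fin n)) (extChartAt (𝓡 n) p) q v := by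
  rw [← TangentBundle.continuousLinearMapAt_trivializationAt hq]
  rfl

/-- The tangent space at `p` is the model space as seen by the preferred chart at `p`. A tangent
vector at `p` may thus serve directly as a coordinate velocity. -/
theorem coordOfVector_self (p : X) (v : TangentSpace (𝓡 n) p) : coordOfVector p p v = v := by
  rw [coordOfVector_eq_mfderiv (mem_chart_source _ p), mfderiv_extChartAt_self]
  rfl

theorem vectorOfCoord_self (p : X) (v : TangentSpace (𝓡 n) p) : vectorOfCoord p p v = v := by
  conv_rhs => rw [← vectorOfCoord_coordOfVector (mem_chart_source _ p) v, coordOfVector_self]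

theorem vectorOfCoord_smul (p q : X) (c : ℝ) (a : EuclideanSpace ℝ (Fin n)) :
    vectorOfCoord p q (c • a) = c • vectorOfCoord p q a :=
  ((trivializationAt (EuclideanSpace ℝ (Fin n)) (TangentSpace (𝓡 n) (M := X)) p).symmL ℝ q).map_smul
    c a

/-! ### ### Uniform bounds on future cones -/

namespace Spacetime

/-- The linear form `-⟨u, ·⟩` at `p`, in the coordinates of the chart at `p`. -/
noncomputable def timeForm (S : Spacetime n X) (p : X) (u : TangentSpace (𝓡 n) p) :
    EuclideanSpace ℝ (Fin n) →L[ℝ] ℝ :=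
  -((S.metric.inner p u).comp
    ((trivializationAt (EuclideanSpace ℝ (Fin n)) (TangentSpace (𝓡 n) (M := X)) p).symmL ℝ p))

theorem timeForm_apply (S : Spacetime n X) (p : X) (u : TangentSpace (𝓡 n) p)
    (a : EuclideanSpace ℝ (Fin n)) :
    S.timeForm p u a = -S.metric.inner p u (vectorOfCoord p p a) := rfl

theorem IsFutureVector.causal {S : Spacetime n X} {x : X} {v : TangentSpace (𝓡 n) x}
    (h : S.IsFutureVector .timelike x v) (k : CausalType) : S.IsFutureVector k x v := by
  cases k
  · exact h
  · refine ⟨?_, h.1.le, h.2⟩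
    rintro rfl
    simpa using h.1

theorem IsFutureVector.weaken {S : Spacetime n X} {k : CausalType} {x : X}
    {v : TangentSpace (𝓡 n) x} (h : S.IsFutureVector k x v) : S.IsFutureVector .causal x v := by
  cases k
  · exact h.causal _
  · exact h

theorem IsFutureVector.smul {S : Spacetime n X} {x : X} {v : TangentSpace (𝓡 n) x}
    (h : S.IsFutureVector .timelike x v) {c : ℝ} (hc : 0 < c) :
    S.IsFutureVector .timelike x (c • v) := by
  obtain ⟨h1, h2⟩ := h
  refine ⟨?_, ?_⟩
  · simp only [map_smul, smul_apply, smul_eq_mul]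
    nlinarith [mul_pos hc hc]
  · simp only [map_smul, smul_apply, smul_eq_mul]
    nlinarith

/-- Near `p`, the future causal cones lie in a fixed convex cone on which the linear form given by
a future timelike vector at `p` is positive. -/
theorem exists_cone_bound (S : Spacetime n X) {p : X} {u : TangentSpace (𝓡 n) p}
    (hu : S.IsFutureVector .timelike p u) :
    ∃ K : ℝ, 0 < K ∧ ∃ N ∈ 𝓝 p, IsOpen N ∧ N ⊆ (chartAt (EuclideanSpace ℝ (Fin n)) p).source ∧
      ∀ q ∈ N, ∀ w : TangentSpace (𝓡 n) q, S.IsFutureVector .causal q w →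
        ‖coordOfVector p q w‖ ≤ K * S.timeForm p u (coordOfVector p q w) := by
  set f₁ : X × EuclideanSpace ℝ (Fin n) → ℝ := fun z ↦
    S.metric.inner z.1 (vectorOfCoord p z.1 z.2) (vectorOfCoord p z.1 z.2) with hf₁
  set f₂ : X × EuclideanSpace ℝ (Fin n) → ℝ := fun z ↦
    S.metric.inner z.1 (vectorOfCoord p z.1 z.2) (S.timeField z.1) with hf₂
  have hV : ∀ a : EuclideanSpace ℝ (Fin n), ContinuousWithinAt
      (fun z : X × EuclideanSpace ℝ (Fin n) ↦
        (⟨z.1, vectorOfCoord p z.1 z.2⟩ : TangentBundle (𝓡 n) X)) univ (p, a) := fun a ↦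
    (continuousAt_vectorOfCoord (mem_chart_source _ p) a).continuousWithinAt
  have hT : ∀ a : EuclideanSpace ℝ (Fin n), ContinuousWithinAt
      (fun z : X × EuclideanSpace ℝ (Fin n) ↦
        (⟨z.1, S.timeField z.1⟩ : TangentBundle (𝓡 n) X)) univ (p, a) := fun a ↦
    (S.timeField_continuous.comp continuous_fst).continuousWithinAt
  have c₁ : ∀ a, ContinuousAt f₁ (p, a) := fun a ↦
    continuousWithinAt_univ _ _ |>.1 (S.metric.continuous_inner (hV a) (hV a))
  have c₂ : ∀ a, ContinuousAt f₂ (p, a) := fun a ↦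
    continuousWithinAt_univ _ _ |>.1 (S.metric.continuous_inner (hV a) (hT a))
  have d₁ : Continuous (fun a ↦ f₁ (p, a)) := continuous_iff_continuousAt.2 fun a ↦
    ContinuousAt.comp (f := fun a ↦ (p, a)) (c₁ a) (by fun_prop)
  have d₂ : Continuous (fun a ↦ f₂ (p, a)) := continuous_iff_continuousAt.2 fun a ↦
    ContinuousAt.comp (f := fun a ↦ (p, a)) (c₂ a) (by fun_prop)
  -- The weak inequality on `f₂` makes the set closed. It costs nothing, since a nonzero causal
  -- vector is never orthogonal to the time field.
  have hZ : IsCompact (Metric.sphere (0 : EuclideanSpace ℝ (Fin n)) 1 ∩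
      {a | f₁ (p, a) ≤ 0 ∧ f₂ (p, a) ≤ 0}) :=
    (isCompact_sphere _ _).inter_right
      ((isClosed_le d₁ continuous_const).inter (isClosed_le d₂ continuous_const))
  obtain ⟨δ, hδ, hle⟩ := hZ.exists_forall_le' (f := S.timeForm p u)
    (S.timeForm p u).continuous.continuousOn (a := 0) (by
      rintro a ⟨ha, ha₁, ha₂⟩
      have ha0 : vectorOfCoord p p a ≠ 0 := by
        intro h
        have := coordOfVector_vectorOfCoord (mem_chart_source _ p) a
        rw [h, map_zero] at this
        simp [← this] at ha
      have hL := S.metric.isLorentzForm p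
      have h := hL.neg_of_future (t := S.timeField p) (u := u) (w := vectorOfCoord p p a)
        (S.timeField_timelike p) hu.1 hu.2 ha₁ (lt_of_le_of_ne ha₂
          (hL.ne_zero_of_causal (S.timeField_timelike p) ha₁ ha0))
      rw [timeForm_apply, S.metric.symm]
      exact neg_pos.2 h)
  -- "A future causal vector has form value above `δ / 2`" is written as positivity of a maximum of
  -- continuous functions: an open condition, which spreads to nearby base points by compactness of
  -- the sphere.
  have key := (isCompact_sphere (0 : EuclideanSpace ℝ (Fin n)) 1).eventually_forall_of_forall_eventually
    (x₀ := p) (P := fun q a ↦ 0 < max (max (f₁ (q, a)) (f₂ (q, a))) (S.timeForm p u a - δ / 2)) (by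
      intro a ha
      have hc : ContinuousAt (fun z : X × EuclideanSpace ℝ (Fin n) ↦
          max (max (f₁ z) (f₂ z)) (S.timeForm p u z.2 - δ / 2)) (p, a) :=
        ((c₁ a).max (c₂ a)).max (((S.timeForm p u).continuous.comp
          continuous_snd).continuousAt.sub continuousAt_const)
      refine hc.eventually (lt_mem_nhds ?_)
      by_contra! h
      simp only [max_le_iff] at h
      have := hle a ⟨ha, h.1.1, h.1.2⟩
      linarith [h.2])
  have hsrc := (chartAt (EuclideanSpace ℝ (Fin n)) p).open_source.mem_nhds (mem_chart_source _ p)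
  obtain ⟨N, hN, hNo, hpN⟩ := mem_nhds_iff.1 (Filter.inter_mem key hsrc)
  refine ⟨2 / δ, by positivity, N, hNo.mem_nhds hpN, hNo, fun q hq ↦ (hN hq).2, fun q hq w hw ↦ ?_⟩
  have hqs := (hN hq).2
  set a := coordOfVector p q w with ha
  have hwa : vectorOfCoord p q a = w := vectorOfCoord_coordOfVector hqs w
  have ha0 : a ≠ 0 := by
    intro h
    rw [h] at hwa
    refine hw.1 (hwa.symm.trans ?_)
    exact map_zero _
  have hn : 0 < ‖a‖ := norm_pos_iff.2 ha0
  have h := (hN hq).1 (‖a‖⁻¹ • a) (by simp [norm_smul, hn.ne'])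
  have e₁ : f₁ (q, ‖a‖⁻¹ • a) ≤ 0 := by
    simp only [hf₁, vectorOfCoord_smul, hwa, map_smul, smul_apply, smul_eq_mul]
    have := hw.2.1
    have h3 : 0 < ‖a‖⁻¹ := by positivity
    nlinarith [mul_pos h3 h3]
  have e₂ : f₂ (q, ‖a‖⁻¹ • a) ≤ 0 := by
    simp only [hf₂, vectorOfCoord_smul, hwa, map_smul, smul_apply, smul_eq_mul]
    exact mul_nonpos_of_nonneg_of_nonpos (by positivity) hw.2.2.le
  have e₃ : δ / 2 < S.timeForm p u (‖a‖⁻¹ • a) := by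
    rcases lt_max_iff.1 h with h | h
    · rcases lt_max_iff.1 h with h | h <;> linarith
    · linarith
  rw [map_smul, smul_eq_mul, inv_mul_eq_div, lt_div_iff₀ hn] at e₃
  rw [div_mul_eq_mul_div, le_div_iff₀ hδ]
  linarith

end Spacetime

end Cone

/-! ### Cone order along curves and paths -/

section ConeOrder

universe u

variable {n : ℕ} {X : Type u} [TopologicalSpace X]
  [ChartedSpace (EuclideanSpace ℝ (Fin n)) X]

/-- A local relation that is transitive holds between all parameters of a path. -/
theorem rel_of_locally_rel {r : I → I → Prop} (htrans : ∀ a b c, r a b → r b c → r a c)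
    (hloc : ∀ t₀ : I, ∃ V ∈ 𝓝 t₀, ∀ s ∈ V, ∀ t ∈ V, s < t → r s t) {s t : I} (hst : s < t) :
    r s t := by
  have h' : ∀ t₀ : I, ∃ V, IsOpen V ∧ t₀ ∈ V ∧ ∀ s ∈ V, ∀ t ∈ V, s < t → r s t := by
    intro t₀
    obtain ⟨V, hV, h⟩ := hloc t₀
    obtain ⟨W, hWV, hWo, hW⟩ := mem_nhds_iff.1 hV
    exact ⟨W, hWo, hW, fun s hs t ht ↦ h s (hWV hs) t (hWV ht)⟩
  choose V hVo hV hr using h'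
  obtain ⟨τ, hτ0, hτm, ⟨N, hN⟩, hτ⟩ := exists_monotone_Icc_subset_open_cover_unitInterval hVo
    (fun x _ ↦ mem_iUnion.2 ⟨x, hV x⟩)
  -- Induction along a subdivision whose pieces each lie in one of the good open sets.
  have key : ∀ k, ∀ a b : I, a < b → b ≤ τ k → r a b := by
    intro k
    induction k with
    | zero =>
      intro a b hab hb
      rw [hτ0] at hb
      exact absurd (hab.trans_le hb) (not_lt.2 a.2.1)
    | succ k ih =>
      intro a b hab hb
      obtain ⟨i, hi⟩ := hτ k
      rcases le_or_gt b (τ k) with h1 | h1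
      · exact ih a b hab h1
      · rcases le_or_gt (τ k) a with h2 | h2
        · exact hr i a (hi ⟨h2, hab.le.trans hb⟩) b (hi ⟨h1.le, hb⟩) hab
        · exact htrans _ _ _ (ih a _ h2 le_rfl)
            (hr i _ (hi ⟨le_rfl, hτm (Nat.le_succ k)⟩) b (hi ⟨h1.le, hb⟩) h1)
  exact key N s t hst (by rw [hN N le_rfl]; exact t.2.2)

namespace Spacetime

/-- The order defined by a convex cone in the coordinates of the chart at `p`. -/
def ConeLE (p : X) (K : ℝ) (ℓ : EuclideanSpace ℝ (Fin n) →L[ℝ] ℝ) (x y : X) : Prop :=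
  ‖extChartAt (𝓡 n) p y - extChartAt (𝓡 n) p x‖ ≤
    K * ℓ (extChartAt (𝓡 n) p y - extChartAt (𝓡 n) p x)

theorem ConeLE.trans {p : X} {K : ℝ} {ℓ : EuclideanSpace ℝ (Fin n) →L[ℝ] ℝ} {x y z : X}
    (h₁ : ConeLE p K ℓ x y) (h₂ : ConeLE p K ℓ y z) : ConeLE p K ℓ x z := by
  unfold ConeLE at *
  have e : extChartAt (𝓡 n) p z - extChartAt (𝓡 n) p x =
      (extChartAt (𝓡 n) p z - extChartAt (𝓡 n) p y) +
        (extChartAt (𝓡 n) p y - extChartAt (𝓡 n) p x) := by abel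
  rw [e, map_add, mul_add]
  exact (norm_add_le _ _).trans (by linarith)

theorem coneLE_refl (p : X) (K : ℝ) (ℓ : EuclideanSpace ℝ (Fin n) →L[ℝ] ℝ) (x : X) :
    ConeLE p K ℓ x x := by
  simp [ConeLE]

theorem ConeLE.nonneg {p : X} {K : ℝ} (hK : 0 < K) {ℓ : EuclideanSpace ℝ (Fin n) →L[ℝ] ℝ}
    {x y : X} (h : ConeLE p K ℓ x y) :
    0 ≤ ℓ (extChartAt (𝓡 n) p y - extChartAt (𝓡 n) p x) :=
  nonneg_of_mul_nonneg_right ((norm_nonneg _).trans h) hK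

/-- The preimage of a coordinate ball around `p` under the chart at `p`. -/
def chartBall (p : X) (r : ℝ) : Set X :=
  (chartAt (EuclideanSpace ℝ (Fin n)) p).source ∩
    extChartAt (𝓡 n) p ⁻¹' Metric.ball (extChartAt (𝓡 n) p p) r

theorem isOpen_chartBall (p : X) (r : ℝ) : IsOpen (chartBall (n := n) p r) := by
  have hc : ContinuousOn (extChartAt (𝓡 n) p) (extChartAt (𝓡 n) p).source :=
    continuousOn_extChartAt p
  have := hc.isOpen_inter_preimage (isOpen_extChartAt_source p) (Metric.isOpen_ball (x := extChartAt (𝓡 n) p p) (ε := r))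
  rwa [extChartAt_source] at this

theorem exists_chartBall_subset {p : X} {N : Set X} (hN : N ∈ 𝓝 p) :
    ∃ r : ℝ, 0 < r ∧ chartBall (n := n) p r ⊆ N ∧
      Metric.ball (extChartAt (𝓡 n) p p) r ⊆ (extChartAt (𝓡 n) p).target := by
  have h1 : (extChartAt (𝓡 n) p).symm ⁻¹' N ∈ 𝓝 (extChartAt (𝓡 n) p p) :=
    extChartAt_preimage_mem_nhds hN
  obtain ⟨r, hr, hsub⟩ := Metric.mem_nhds_iff.1
    (Filter.inter_mem h1 (extChartAt_target_mem_nhds p))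
  refine ⟨r, hr, ?_, fun z hz ↦ (hsub hz).2⟩
  rintro x ⟨hx, hxr⟩
  have := (hsub hxr).1
  rw [mem_preimage, (extChartAt (𝓡 n) p).left_inv (by rwa [extChartAt_source])] at this
  exact this

/-- The set is the image of a compact ball under the inverse chart, hence compact, hence closed in
the whole Hausdorff space and not only in the chart domain. -/
theorem isClosed_closedChartBall [T2Space X] {p : X} {r ρ : ℝ} (hρ : ρ < r)
    (hr : Metric.ball (extChartAt (𝓡 n) p p) r ⊆ (extChartAt (𝓡 n) p).target) :
    IsClosed ((extChartAt (𝓡 n) p).source ∩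
      extChartAt (𝓡 n) p ⁻¹' Metric.closedBall (extChartAt (𝓡 n) p p) ρ) := by
  have hsub := (Metric.closedBall_subset_ball hρ).trans hr
  have hc : ContinuousOn (extChartAt (𝓡 n) p).symm (extChartAt (𝓡 n) p).target :=
    continuousOn_extChartAt_symm p
  have h := (isCompact_closedBall (extChartAt (𝓡 n) p p) ρ).image_of_continuousOn (hc.mono hsub)
  rw [(extChartAt (𝓡 n) p).symm_image_eq_source_inter_preimage hsub] at h
  exact h.isClosed

variable [IsManifold (𝓡 n) ∞ X]

/-- All future causal vectors at points of `N` lie in the cone given by `K` and `ℓ`. -/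
def ConeBound (S : Spacetime n X) (p : X) (K : ℝ) (ℓ : EuclideanSpace ℝ (Fin n) →L[ℝ] ℝ)
    (N : Set X) : Prop :=
  N ⊆ (chartAt (EuclideanSpace ℝ (Fin n)) p).source ∧
    ∀ q ∈ N, ∀ w : TangentSpace (𝓡 n) q, S.IsFutureVector .causal q w →
      ‖coordOfVector p q w‖ ≤ K * ℓ (coordOfVector p q w)

variable {S : Spacetime n X} {p : X} {K : ℝ} {ℓ : EuclideanSpace ℝ (Fin n) →L[ℝ] ℝ} {N : Set X}

/-- Integrate the cone bound: `K * ℓ (c')` dominates `‖c'‖` and is the derivative of `K * ℓ (c - c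
0)`, so the mean value inequality with a moving bound applies. -/
theorem ConeBound.of_hasSmoothCurve (hN : S.ConeBound p K ℓ N) {k : CausalType} {x y : X}
    (h : S.HasSmoothCurve k N x y) : ConeLE p K ℓ x y := by
  obtain ⟨γ, hγ, rfl, rfl, hmem, hfut⟩ := h
  set c : ℝ → EuclideanSpace ℝ (Fin n) := fun t ↦ extChartAt (𝓡 n) p (γ t)
  set c' : ℝ → EuclideanSpace ℝ (Fin n) := fun t ↦
    coordOfVector p (γ t) (mfderivWithin 𝓘(ℝ, ℝ) (𝓡 n) γ (Icc 0 1) t (1 : ℝ))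
  have hd : ∀ t ∈ Icc (0 : ℝ) 1, HasDerivWithinAt c (c' t) (Icc 0 1) t := by
    intro t ht
    have h1 := ((hγ t ht).mdifferentiableWithinAt (by simp)).hasMFDerivWithinAt
    have h2 := (show MDifferentiableAt (𝓡 n) 𝓘(ℝ, EuclideanSpace ℝ (Fin n)) (extChartAt (𝓡 n) p) (γ t) from
      mdifferentiableAt_extChartAt (hN.1 (hmem t ht))).hasMFDerivAt
    have h3 := h2.comp_hasMFDerivWithinAt t h1
    set L : ℝ →L[ℝ] EuclideanSpace ℝ (Fin n) :=
      (mfderiv (𝓡 n) 𝓘(ℝ, EuclideanSpace ℝ (Fin n)) (extChartAt (𝓡 n) p) (γ t)).comp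
        (mfderivWithin 𝓘(ℝ, ℝ) (𝓡 n) γ (Icc 0 1) t) with hL
    have h4 : HasFDerivWithinAt c L (Icc 0 1) t := hasMFDerivWithinAt_iff_hasFDerivWithinAt.1 h3
    have e : c' t = L 1 := coordOfVector_eq_mfderiv (hN.1 (hmem t ht)) _
    rw [e]
    exact h4.hasDerivWithinAt
  have hd' : ∀ t ∈ Ico (0 : ℝ) 1, HasDerivWithinAt c (c' t) (Ici t) t := fun t ht ↦
    (hd t (Ico_subset_Icc_self ht)).mono_of_mem_nhdsWithin
      (Filter.mem_of_superset (Icc_mem_nhdsGE ht.2) (Icc_subset_Icc_left ht.1))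
  have hc : ContinuousOn c (Icc 0 1) := fun t ht ↦ (hd t ht).continuousWithinAt
  refine image_norm_le_of_norm_deriv_right_le_deriv_boundary'
    (f := fun t ↦ c t - c 0) (f' := c') (B := fun t ↦ K * ℓ (c t - c 0))
    (B' := fun t ↦ K * ℓ (c' t)) (a := 0) (b := 1)
    (hc.sub continuousOn_const) (fun t ht ↦ (hd' t ht).sub_const _) (by simp)
    (continuousOn_const.mul (ℓ.continuous.comp_continuousOn (hc.sub continuousOn_const)))
    (fun t ht ↦ ?_) (fun t ht ↦ ?_) (right_mem_Icc.2 zero_le_one)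
  · exact (ℓ.hasFDerivAt.comp_hasDerivWithinAt t ((hd' t ht).sub_const _)).const_mul K
  · have ht' := Ico_subset_Icc_self ht
    exact hN.2 _ (hmem t ht') _ (hfut t ht').weaken

theorem ConeBound.of_precedes (hN : S.ConeBound p K ℓ N) {k : CausalType} {x y : X}
    (h : S.Precedes k N x y) : ConeLE p K ℓ x y := by
  cases k
  · change Relation.TransGen _ _ _ at h
    induction h with
    | single h => exact hN.of_hasSmoothCurve h
    | tail _ h ih => exact ih.trans (hN.of_hasSmoothCurve h)
  · change Relation.ReflTransGen _ _ _ at h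
    induction h with
    | refl => exact coneLE_refl _ _ _ _
    | tail _ h ih => exact ih.trans (hN.of_hasSmoothCurve h)

/-- A future path in `N` is monotone for the cone order. -/
theorem ConeBound.of_isFuturePath (hN : S.ConeBound p K ℓ N) (hNo : IsOpen N) {k : CausalType}
    {c : I → X} (hc : S.IsFuturePath k c) (hmem : ∀ t, c t ∈ N) {s t : I} (hst : s ≤ t) :
    ConeLE p K ℓ (c s) (c t) := by
  rcases hst.eq_or_lt with rfl | hst
  · exact coneLE_refl _ _ _ _
  · refine rel_of_locally_rel (r := fun s t ↦ ConeLE p K ℓ (c s) (c t))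
      (fun _ _ _ ↦ ConeLE.trans) (fun t₀ ↦ ?_) hst
    obtain ⟨V, hV, h⟩ := hc t₀ N hNo (hmem t₀)
    exact ⟨V, hV, fun s hs t ht hst ↦ hN.of_precedes (h s hs t ht hst)⟩

theorem ConeBound.mono (hN : S.ConeBound p K ℓ N) {M : Set X} (h : M ⊆ N) :
    S.ConeBound p K ℓ M :=
  ⟨h.trans hN.1, fun q hq ↦ hN.2 q (h hq)⟩

/-- A future path that starts at `p`, ends close to `p`, and stays in a small chart ball, cannot
leave this ball in a homotopy through future paths. -/
theorem ConeBound.homotopic_mem_chartBall [T2Space X] (hN : S.ConeBound p K ℓ N) (hK : 0 < K)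
    {r : ℝ} (hrN : chartBall (n := n) p r ⊆ N)
    (hr : Metric.ball (extChartAt (𝓡 n) p p) r ⊆ (extChartAt (𝓡 n) p).target)
    {k : CausalType} {y : X}
    (hy : K * ℓ (extChartAt (𝓡 n) p y - extChartAt (𝓡 n) p p) < r) {c d : Path p y}
    (hcd : S.Homotopic k c d) (hc : ∀ t, c t ∈ chartBall (n := n) p r) (t : I) :
    d t ∈ chartBall (n := n) p r := by
  obtain ⟨H, hH⟩ := hcd
  -- The parameters whose whole path lies in the ball form a nonempty clopen subset of `I`.
  set A : Set I := {s | ∀ t, H (s, t) ∈ chartBall (n := n) p r} with hA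
  set ρ := K * ℓ (extChartAt (𝓡 n) p y - extChartAt (𝓡 n) p p)
  -- The path runs in cone order from `p` through `H (s, t)` to `y`, so the distance from `p` is at
  -- most `K * ℓ` of the displacement to `H (s, t)`, which is at most `ρ < r`.
  have hbd : ∀ s ∈ A, ∀ t, H (s, t) ∈ (extChartAt (𝓡 n) p).source ∩
      extChartAt (𝓡 n) p ⁻¹' Metric.closedBall (extChartAt (𝓡 n) p p) ρ := by
    intro s hs t
    have hb := hN.mono hrN
    have h0 := hb.of_isFuturePath (isOpen_chartBall p r) (hH s) hs (s := 0) (t := t) t.2.1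
    have h1 := (hb.of_isFuturePath (isOpen_chartBall p r) (hH s) hs (s := t) (t := 1)
      t.2.2).nonneg hK
    have e0 : H.eval s 0 = p := (H.eval s).source
    have e1 : H.eval s 1 = y := (H.eval s).target
    rw [e0] at h0
    rw [e1] at h1
    refine ⟨by rw [extChartAt_source]; exact (hs t).1, ?_⟩
    rw [mem_preimage, mem_closedBall_iff_norm]
    refine le_trans h0 (mul_le_mul_of_nonneg_left ?_ hK.le)
    simp only [map_sub] at h1 ⊢
    linarith
  have hopen : IsOpen A := by
    rw [isOpen_iff_mem_nhds]
    intro s hs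
    refine (isCompact_univ (X := I)).eventually_forall_of_forall_eventually
      (P := fun s t ↦ H (s, t) ∈ chartBall (n := n) p r) (x₀ := s) (fun t _ ↦ ?_) |>.mono
      fun s hs t ↦ hs t (mem_univ t)
    exact H.continuous.continuousAt.preimage_mem_nhds ((isOpen_chartBall p r).mem_nhds (hs t))
  have hclosed : IsClosed A := by
    have e : A = ⋂ t : I, (fun s ↦ H (s, t)) ⁻¹' ((extChartAt (𝓡 n) p).source ∩
        extChartAt (𝓡 n) p ⁻¹' Metric.closedBall (extChartAt (𝓡 n) p p) ρ) := by
      ext s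
      simp only [mem_iInter]
      refine ⟨hbd s, fun h t ↦ ⟨?_, Metric.closedBall_subset_ball hy (h t).2⟩⟩
      have := (h t).1
      rwa [extChartAt_source] at this
    rw [e]
    exact isClosed_iInter fun t ↦ (isClosed_closedChartBall hy hr).preimage
      (H.continuous.comp (by fun_prop))
  have huniv : A = univ := IsClopen.eq_univ ⟨hclosed, hopen⟩ ⟨0, fun t ↦ by
    rw [H.apply_zero]; exact hc t⟩
  have h1 : (1 : I) ∈ A := huniv ▸ mem_univ _
  have := h1 t
  rwa [H.apply_one] at this

end Spacetime

end ConeOrder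

/-! ### Short timelike curves -/

section ShortCurve

universe u

variable {n : ℕ} {X : Type u} [TopologicalSpace X]
  [ChartedSpace (EuclideanSpace ℝ (Fin n)) X]

/-- The curve with constant velocity `w` from `e` in the coordinates of the chart at `p`. -/
noncomputable def coordLine (p : X) (e w : EuclideanSpace ℝ (Fin n)) (s : ℝ) : X :=
  (extChartAt (𝓡 n) p).symm (e + s • w)

theorem continuous_line (e w : EuclideanSpace ℝ (Fin n)) : Continuous (fun s : ℝ ↦ e + s • w) := by
  fun_prop

theorem coordLine_zero (p : X) (w : EuclideanSpace ℝ (Fin n)) :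
    coordLine p (extChartAt (𝓡 n) p p) w 0 = p := by
  rw [coordLine, zero_smul, add_zero]
  exact extChartAt_to_inv p

theorem coordLine_mem_source {p : X} {e w : EuclideanSpace ℝ (Fin n)} {s : ℝ}
    (hs : e + s • w ∈ (extChartAt (𝓡 n) p).target) :
    coordLine p e w s ∈ (chartAt (EuclideanSpace ℝ (Fin n)) p).source := by
  have := (extChartAt (𝓡 n) p).map_target hs
  rwa [extChartAt_source] at this

theorem eventually_line_mem_target {p : X} {e w : EuclideanSpace ℝ (Fin n)} {s : ℝ}
    (hs : e + s • w ∈ (extChartAt (𝓡 n) p).target) :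
    ∀ᶠ s' in 𝓝 s, e + s' • w ∈ (extChartAt (𝓡 n) p).target :=
  (continuous_line e w).continuousAt.preimage_mem_nhds
    ((isOpen_extChartAt_target p).mem_nhds hs)

variable [IsManifold (𝓡 n) ∞ X]

theorem contMDiffAt_coordLine {p : X} {e w : EuclideanSpace ℝ (Fin n)} {s : ℝ}
    (hs : e + s • w ∈ (extChartAt (𝓡 n) p).target) :
    ContMDiffAt 𝓘(ℝ, ℝ) (𝓡 n) ∞ (coordLine p e w) s := by
  have h1 : ContMDiffAt 𝓘(ℝ, EuclideanSpace ℝ (Fin n)) (𝓡 n) ∞ (extChartAt (𝓡 n) p).symm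
      (e + s • w) :=
    (contMDiffOn_extChartAt_symm p _ hs).contMDiffAt ((isOpen_extChartAt_target p).mem_nhds hs)
  have h2 : ContMDiffAt 𝓘(ℝ, ℝ) 𝓘(ℝ, EuclideanSpace ℝ (Fin n)) ∞ (fun s : ℝ ↦ e + s • w) s :=
    (contDiff_const.add (contDiff_id.smul contDiff_const)).contMDiff.contMDiffAt
  exact ContMDiffAt.comp s h1 h2

/-- In the chart the curve is the affine line `e + s • w` near the parameter; uniqueness of
derivatives identifies its velocity. -/
theorem mfderiv_coordLine {p : X} {e w : EuclideanSpace ℝ (Fin n)} {s : ℝ}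
    (hs : e + s • w ∈ (extChartAt (𝓡 n) p).target) :
    mfderiv 𝓘(ℝ, ℝ) (𝓡 n) (coordLine p e w) s (1 : ℝ) =
      vectorOfCoord p (coordLine p e w s) w := by
  have hsrc := coordLine_mem_source hs
  rw [← vectorOfCoord_coordOfVector hsrc
    (mfderiv 𝓘(ℝ, ℝ) (𝓡 n) (coordLine p e w) s (1 : ℝ))]
  congr 1
  rw [coordOfVector_eq_mfderiv hsrc]
  have h1 := ((contMDiffAt_coordLine hs).mdifferentiableAt (by simp)).hasMFDerivAt
  have h2 := (show MDifferentiableAt (𝓡 n) 𝓘(ℝ, EuclideanSpace ℝ (Fin n)) (extChartAt (𝓡 n) p)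
    (coordLine p e w s) from mdifferentiableAt_extChartAt hsrc).hasMFDerivAt
  have h3 := h2.comp s h1
  set L : ℝ →L[ℝ] EuclideanSpace ℝ (Fin n) :=
    (mfderiv (𝓡 n) 𝓘(ℝ, EuclideanSpace ℝ (Fin n)) (extChartAt (𝓡 n) p) (coordLine p e w s)).comp
      (mfderiv 𝓘(ℝ, ℝ) (𝓡 n) (coordLine p e w) s) with hL
  have h4 : HasFDerivAt (fun s ↦ extChartAt (𝓡 n) p (coordLine p e w s)) L s :=
    hasMFDerivAt_iff_hasFDerivAt.1 h3
  have h5 : HasDerivAt (fun s : ℝ ↦ e + s • w) ((1 : ℝ) • w) s :=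
    ((hasDerivAt_id s).smul_const w).const_add e
  have h6 : (fun s ↦ extChartAt (𝓡 n) p (coordLine p e w s)) =ᶠ[𝓝 s] fun s : ℝ ↦ e + s • w := by
    filter_upwards [eventually_line_mem_target hs] with s' hs'
    exact (extChartAt (𝓡 n) p).right_inv hs'
  have h7 := h4.hasDerivAt.unique (h5.congr_of_eventuallyEq h6)
  rw [one_smul] at h7
  exact h7

namespace Spacetime

/-- Curves with constant coordinate velocity are smooth curves in the sense of the causal
relations, where their velocity is timelike. -/
theorem hasSmoothCurve_coordLine {S : Spacetime n X} (k : CausalType) {p : X}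
    {e w : EuclideanSpace ℝ (Fin n)} {U : Set X} {a b : ℝ} (hab : a < b)
    (h : ∀ s ∈ Icc a b, e + s • w ∈ (extChartAt (𝓡 n) p).target ∧ coordLine p e w s ∈ U ∧
      S.IsFutureVector .timelike (coordLine p e w s) (vectorOfCoord p (coordLine p e w s) w)) :
    S.HasSmoothCurve k U (coordLine p e w a) (coordLine p e w b) := by
  -- The affine change of parameter from `[0, 1]` to `[a, b]` multiplies the velocity by `b - a >
  -- 0`.
  have hlin : ∀ r : ℝ, (e + a • w) + r • ((b - a) • w) = e + (a + r * (b - a)) • w := by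
    intro r
    module
  have hcl : ∀ r : ℝ, coordLine p (e + a • w) ((b - a) • w) r =
      coordLine p e w (a + r * (b - a)) := fun r ↦ by
    rw [coordLine, hlin, coordLine]
  have hmem : ∀ r ∈ Icc (0 : ℝ) 1, a + r * (b - a) ∈ Icc a b := by
    intro r hr
    constructor
    · nlinarith [hr.1]
    · nlinarith [hr.2]
  have ht : ∀ r ∈ Icc (0 : ℝ) 1,
      (e + a • w) + r • ((b - a) • w) ∈ (extChartAt (𝓡 n) p).target := by
    intro r hr
    rw [hlin]
    exact (h _ (hmem r hr)).1
  refine ⟨coordLine p (e + a • w) ((b - a) • w), fun r hr ↦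
    (contMDiffAt_coordLine (ht r hr)).contMDiffWithinAt, by simp [hcl], by simp [hcl],
    fun r hr ↦ ?_, fun r hr ↦ ?_⟩
  · rw [hcl]
    exact (h _ (hmem r hr)).2.1
  · rw [mfderivWithin_eq_mfderiv
      (uniqueMDiffWithinAt_iff_uniqueDiffWithinAt.2 (uniqueDiffOn_Icc zero_lt_one r hr))
      ((contMDiffAt_coordLine (ht r hr)).mdifferentiableAt (by simp)),
      mfderiv_coordLine (ht r hr), vectorOfCoord_smul, hcl]
    exact ((h _ (hmem r hr)).2.2.smul (sub_pos.2 hab)).causal k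

/-- Short curves with constant coordinate velocity and future timelike initial velocity are future
paths. -/
theorem eventually_exists_futurePath (S : Spacetime n X) (k : CausalType) {p : X}
    {v : TangentSpace (𝓡 n) p} (hv : S.IsFutureVector .timelike p v) {U : Set X} (hU : U ∈ 𝓝 p) :
    ∀ᶠ t in 𝓝[>] (0 : ℝ), ∃ c : Path p (coordLine p (extChartAt (𝓡 n) p p) v t),
      S.IsFuturePath k c ∧ ∀ s, c s ∈ U := by
  set e := extChartAt (𝓡 n) p p
  set w : EuclideanSpace ℝ (Fin n) := v with hw
  have hs0 : e + (0 : ℝ) • w ∈ (extChartAt (𝓡 n) p).target := by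
    rw [zero_smul, add_zero]
    exact mem_extChartAt_target p
  have h0 : coordLine p e w 0 = p := coordLine_zero p w
  have hc0 := (contMDiffAt_coordLine hs0).continuousAt
  have hV : ContinuousAt (fun s ↦ (⟨coordLine p e w s, vectorOfCoord p (coordLine p e w s) w⟩ :
      TangentBundle (𝓡 n) X)) 0 :=
    ContinuousAt.comp (f := fun s ↦ (coordLine p e w s, w))
      (continuousAt_vectorOfCoord (coordLine_mem_source hs0) w) (hc0.prodMk continuousAt_const)
  have hT : ContinuousAt (fun s ↦ (⟨coordLine p e w s, S.timeField (coordLine p e w s)⟩ :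
      TangentBundle (𝓡 n) X)) 0 :=
    ContinuousAt.comp (f := fun s ↦ coordLine p e w s)
      (S.timeField_continuous.continuousAt) hc0
  have hv0 : S.IsFutureVector .timelike (coordLine p e w 0)
      (vectorOfCoord p (coordLine p e w 0) w) := by
    rw [h0, hw, vectorOfCoord_self]
    exact hv
  have i₁ := (continuousWithinAt_univ _ _).1
    (S.metric.continuous_inner hV.continuousWithinAt (hV.continuousWithinAt (s := univ)))
  have i₂ := (continuousWithinAt_univ _ _).1
    (S.metric.continuous_inner hV.continuousWithinAt (hT.continuousWithinAt (s := univ)))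
  have hev : ∀ᶠ s in 𝓝 (0 : ℝ), e + s • w ∈ (extChartAt (𝓡 n) p).target ∧ coordLine p e w s ∈ U ∧
      S.IsFutureVector .timelike (coordLine p e w s) (vectorOfCoord p (coordLine p e w s) w) :=
    (eventually_line_mem_target hs0).and ((hc0.eventually_mem (by rwa [h0])).and
      ((i₁.eventually (gt_mem_nhds hv0.1)).and (i₂.eventually (gt_mem_nhds hv0.2))))
  obtain ⟨ε, hε, hball⟩ := Metric.eventually_nhds_iff_ball.1 hev
  filter_upwards [Ioo_mem_nhdsGT hε] with t ht
  have hts : ∀ s : I, t * (s : ℝ) ∈ Metric.ball (0 : ℝ) ε := by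
    intro s
    rw [mem_ball_zero_iff, Real.norm_of_nonneg (mul_nonneg ht.1.le s.2.1)]
    nlinarith [s.2.2, ht.1, ht.2]
  have hcont : Continuous (fun s : I ↦ coordLine p e w (t * s)) := continuous_iff_continuousAt.2
    fun s ↦ ContinuousAt.comp (f := fun s : I ↦ t * (s : ℝ))
      (contMDiffAt_coordLine (hball _ (hts s)).1).continuousAt (by fun_prop)
  refine ⟨⟨⟨fun s ↦ coordLine p e w (t * s), hcont⟩, by simp [h0], by simp⟩, ?_,
    fun s ↦ (hball _ (hts s)).2.1⟩
  intro t₀ O hO ht₀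
  change coordLine p e w (t * t₀) ∈ O at ht₀
  have hO' := (contMDiffAt_coordLine (hball _ (hts t₀)).1).continuousAt.preimage_mem_nhds
    (hO.mem_nhds ht₀)
  obtain ⟨η, hη, hηO⟩ := Metric.mem_nhds_iff.1
    (Filter.inter_mem hO' (Metric.isOpen_ball.mem_nhds (hts t₀)))
  refine ⟨(fun s : I ↦ t * (s : ℝ)) ⁻¹' Metric.ball (t * t₀) η,
    Continuous.continuousAt (by fun_prop) |>.preimage_mem_nhds (Metric.ball_mem_nhds _ hη),
    fun a ha b hb hab ↦ ?_⟩
  have hlt : t * (a : ℝ) < t * b := mul_lt_mul_of_pos_left hab ht.1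
  have hcurve : S.HasSmoothCurve k O (coordLine p e w (t * a)) (coordLine p e w (t * b)) := by
    refine hasSmoothCurve_coordLine k hlt fun s hs ↦ ?_
    -- The ball is an interval, so it contains every parameter between those of the two endpoints.
    have hsη : s ∈ Metric.ball (t * (t₀ : ℝ)) η := by
      rw [Real.ball_eq_Ioo] at *
      exact ⟨ha.1.trans_le hs.1, hs.2.trans_lt hb.2⟩
    exact ⟨(hball s (hηO hsη).2).1, (hηO hsη).1, (hball s (hηO hsη).2).2.2⟩
  cases k
  · exact Relation.TransGen.single hcurve
  · exact Relation.ReflTransGen.single hcurve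

end Spacetime

end ShortCurve

/-! ### Factorizations of homotopy classes -/

section Factorization

universe u v

variable {n m : ℕ} {X : Type u} [TopologicalSpace X]
  [ChartedSpace (EuclideanSpace ℝ (Fin n)) X] [IsManifold (𝓡 n) ∞ X]
  {Y : Type v} [TopologicalSpace Y]
  [ChartedSpace (EuclideanSpace ℝ (Fin m)) Y] [IsManifold (𝓡 m) ∞ Y]

namespace Spacetime

variable {S : Spacetime n X} {k : CausalType}

/-- A future path can be split at every interior parameter. -/
theorem exists_homotopic_trans {x y : X} {c : Path x y} (hc : S.IsFuturePath k c) {s : I}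
    (hs₀ : 0 < s) (hs₁ : s < 1) :
    ∃ (c₁ : Path x (c s)) (c₂ : Path (c s) y), S.IsFuturePath k c₁ ∧ S.IsFuturePath k c₂ ∧
      S.Homotopic k c (c₁.trans c₂) := by
  have hs₀' : (0 : ℝ) < s := hs₀
  have hs₁' : (0 : ℝ) < 1 - s := sub_pos.2 hs₁
  have m₁ : StrictMono (fun t : I ↦ s * t) := fun a b hab ↦ by
    have hab' : (a : ℝ) < b := hab
    change (s : ℝ) * a < s * b
    nlinarith
  have m₂ : StrictMono (fun t : I ↦ σ (σ s * σ t)) := fun a b hab ↦ by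
    have hab' : (a : ℝ) < b := hab
    change 1 - (1 - (s : ℝ)) * (1 - a) < 1 - (1 - (s : ℝ)) * (1 - b)
    nlinarith
  let c₁ : Path x (c s) := ⟨⟨fun t ↦ c (s * t), by fun_prop⟩, by simp, by simp⟩
  let c₂ : Path (c s) y := ⟨⟨fun t ↦ c (σ (σ s * σ t)), by fun_prop⟩, by simp, by simp⟩
  refine ⟨c₁, c₂, hc.comp (φ := fun t ↦ s * t) (by fun_prop) m₁.monotone fun _ ↦ m₁,
    hc.comp (φ := fun t ↦ σ (σ s * σ t)) (by fun_prop) m₂.monotone fun _ ↦ m₂, ?_⟩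
  -- The concatenation is `c ∘ ψ` with `ψ` of slope `2 s` up to `1/2` and `2 (1 - s)` afterwards.
  -- Both slopes are positive, as the timelike case requires.
  have hmem : ∀ t : I, (s : ℝ) * min (2 * (t : ℝ)) 1 + (1 - s) * max (2 * (t : ℝ) - 1) 0 ∈ I := by
    intro t
    have h1 : min (2 * (t : ℝ)) 1 ≤ 1 := min_le_right _ _
    have h2 : 0 ≤ min (2 * (t : ℝ)) 1 := le_min (by linarith [t.2.1]) zero_le_one
    have h3 : max (2 * (t : ℝ) - 1) 0 ≤ 1 := max_le (by linarith [t.2.2]) zero_le_one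
    have h4 : 0 ≤ max (2 * (t : ℝ) - 1) 0 := le_max_right _ _
    constructor
    · positivity
    · nlinarith
  let ψ : I → I := fun t ↦ ⟨_, hmem t⟩
  have hψc : Continuous ψ := by fun_prop
  have hψ₀ : ψ 0 = 0 := by simp [ψ]
  have hψ₁ : ψ 1 = 1 := by
    apply Subtype.ext
    simp only [ψ, Icc.coe_one]
    norm_num
  have hψm : StrictMono ψ := by
    intro a b hab
    have hab' : (a : ℝ) < b := hab
    change (s : ℝ) * min (2 * (a : ℝ)) 1 + (1 - s) * max (2 * (a : ℝ) - 1) 0 <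
      (s : ℝ) * min (2 * (b : ℝ)) 1 + (1 - s) * max (2 * (b : ℝ) - 1) 0
    rcases le_total (2 * (a : ℝ)) 1 with ha | ha <;> rcases le_total (2 * (b : ℝ)) 1 with hb | hb
    · rw [min_eq_left ha, min_eq_left hb, max_eq_right (by linarith), max_eq_right (by linarith)]
      nlinarith
    · rw [min_eq_left ha, min_eq_right hb, max_eq_right (by linarith), max_eq_left (by linarith)]
      rcases ha.lt_or_eq with ha | ha
      · nlinarith [mul_nonneg hs₁'.le (sub_nonneg.2 hb)]
      · nlinarith
    · linarith
    · rw [min_eq_right ha, min_eq_right hb, max_eq_left (by linarith), max_eq_left (by linarith)]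
      nlinarith
  have he : c₁.trans c₂ = c.reparam ψ hψc hψ₀ hψ₁ := by
    ext t
    rw [Path.trans_apply]
    split_ifs with ht
    · refine congrArg c (Subtype.ext ?_)
      change (s : ℝ) * (2 * t) = s * min (2 * (t : ℝ)) 1 + (1 - s) * max (2 * (t : ℝ) - 1) 0
      rw [min_eq_left (by linarith), max_eq_right (by linarith)]
      ring
    · push Not at ht
      refine congrArg c (Subtype.ext ?_)
      change 1 - (1 - (s : ℝ)) * (1 - (2 * t - 1)) =
        s * min (2 * (t : ℝ)) 1 + (1 - s) * max (2 * (t : ℝ) - 1) 0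
      rw [min_eq_right (by linarith), max_eq_left (by linarith)]
      ring
  rw [he]
  exact Homotopic.reparam hc hψc hψ₀ hψ₁ hψm.monotone fun _ ↦ hψm

/-- The homotopy class `a` is a composite of two classes through the point `z`. -/
def HomotopyClass.FactorsThrough {x y : X} (a : S.HomotopyClass k x y) (z : X) : Prop :=
  ∃ (a₁ : S.HomotopyClass k x z) (a₂ : S.HomotopyClass k z y), a₁.comp a₂ = a

/-- The homotopy class of a future path. -/
def homotopyClassMk {x y : X} (c : Path x y) (hc : S.IsFuturePath k c) : S.HomotopyClass k x y :=
  Quotient.mk (S.homotopySetoid k x y) ⟨c, hc⟩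

/-- Endpoints are excluded because a factorization there would need a class from a point to itself,
which may not exist in the timelike case. -/
theorem factorsThrough_mk {x y : X} {c : Path x y} (hc : S.IsFuturePath k c) {s : I}
    (hs₀ : 0 < s) (hs₁ : s < 1) : (homotopyClassMk c hc).FactorsThrough (c s) := by
  obtain ⟨c₁, c₂, h₁, h₂, h⟩ := exists_homotopic_trans hc hs₀ hs₁
  exact ⟨homotopyClassMk c₁ h₁, homotopyClassMk c₂ h₂,
    Quotient.sound (s := S.homotopySetoid k x y) h.symm⟩

theorem exists_path_of_factorsThrough {x y z : X} {c : Path x y} {hc : S.IsFuturePath k c}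
    (h : (homotopyClassMk c hc).FactorsThrough z) :
    ∃ d : Path x y, S.Homotopic k c d ∧ ∃ t, d t = z := by
  obtain ⟨a₁, a₂, h⟩ := h
  obtain ⟨⟨c₁, h₁⟩, rfl⟩ := Quotient.exists_rep a₁
  obtain ⟨⟨c₂, h₂⟩, rfl⟩ := Quotient.exists_rep a₂
  have h' : S.Homotopic k (c₁.trans c₂) c :=
    Quotient.exact (s := S.homotopySetoid k x y) h
  refine ⟨c₁.trans c₂, h'.symm, ⟨1 / 2, by norm_num⟩, ?_⟩
  rw [Path.trans_apply, dif_pos le_rfl]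
  exact (congrArg c₁ (Subtype.ext (by norm_num))).trans c₁.target

/-- Every class in `S` has a counterpart in `T` whose factorizations give factorizations of it. -/
def ReflectsFactorizations (S : Spacetime n X) (T : Spacetime m Y) (k : CausalType) (f : X ≃ Y) :
    Prop :=
  ∀ (x y : X) (a : S.HomotopyClass k x y), ∃ b : T.HomotopyClass k (f x) (f y),
    ∀ z, b.FactorsThrough z → a.FactorsThrough (f.symm z)

/-- The counterpart of `a` is `F a`: applying `G` to a factorization of `F a` gives one of `G (F a)
= a`. -/
theorem reflectsFactorizations_of_functor {T : Spacetime m Y}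
    {F : CausalCategory S ⥤ CausalCategory T} {G : CausalCategory T ⥤ CausalCategory S}
    (hFG : F ⋙ G = 𝟭 _) {f : X ≃ Y} (hf : ∀ x, F.obj ⟨x⟩ = ⟨f x⟩) (hg : ∀ y, G.obj ⟨y⟩ = ⟨f.symm y⟩) :
    ReflectsFactorizations S T .causal f := by
  intro x y a
  -- Generalizing `F ⋙ G` to a variable `H` lets the equation `H = 𝟭 _` be substituted, with no
  -- transport of morphisms along equalities of objects.
  have key : ∀ (H : CausalCategory S ⥤ CausalCategory S), H = 𝟭 _ → ∀ z : CausalCategory S,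
      (∃ (a₁ : H.obj ⟨x⟩ ⟶ z) (a₂ : z ⟶ H.obj ⟨y⟩),
        a₁ ≫ a₂ = H.map (X := ⟨x⟩) (Y := ⟨y⟩) a) →
      a.FactorsThrough z.pt := by
    rintro _ rfl z ⟨a₁, a₂, h⟩
    exact ⟨a₁, a₂, h⟩
  have key₂ : ∃ b : T.HomotopyClass .causal (F.obj ⟨x⟩).pt (F.obj ⟨y⟩).pt,
      ∀ z, b.FactorsThrough z → a.FactorsThrough (f.symm z) := by
    refine ⟨F.map (X := ⟨x⟩) (Y := ⟨y⟩) a, fun z ⟨b₁, b₂, h⟩ ↦ ?_⟩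
    have h₁ := key _ hFG (G.obj ⟨z⟩) ⟨G.map (X := F.obj ⟨x⟩) (Y := ⟨z⟩) b₁,
      G.map (X := ⟨z⟩) (Y := F.obj ⟨y⟩) b₂,
      (G.map_comp (X := F.obj ⟨x⟩) (Y := ⟨z⟩) (Z := F.obj ⟨y⟩) b₁ b₂).symm.trans
        (congrArg (G.map (X := F.obj ⟨x⟩) (Y := F.obj ⟨y⟩)) h)⟩
    rwa [hg] at h₁
  rwa [hf, hf] at key₂

theorem reflectsFactorizations_of_semifunctor {T : Spacetime m Y}
    {F : Semifunctor (TimelikeSemicategory S) (TimelikeSemicategory T)}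
    {G : Semifunctor (TimelikeSemicategory T) (TimelikeSemicategory S)}
    (hFG : F.comp G = Semifunctor.id _) {f : X ≃ Y} (hf : ∀ x, F.obj ⟨x⟩ = ⟨f x⟩)
    (hg : ∀ y, G.obj ⟨y⟩ = ⟨f.symm y⟩) :
    ReflectsFactorizations S T .timelike f := by
  intro x y a
  have key : ∀ (H : Semifunctor (TimelikeSemicategory S) (TimelikeSemicategory S)),
      H = Semifunctor.id _ → ∀ z : TimelikeSemicategory S,
      (∃ (a₁ : Semicategory.Hom (H.obj ⟨x⟩) z) (a₂ : Semicategory.Hom z (H.obj ⟨y⟩)),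
        Semicategory.comp a₁ a₂ = H.map (x := ⟨x⟩) (y := ⟨y⟩) a) →
      a.FactorsThrough z.pt := by
    rintro _ rfl z ⟨a₁, a₂, h⟩
    exact ⟨a₁, a₂, h⟩
  have key₂ : ∃ b : T.HomotopyClass .timelike (F.obj ⟨x⟩).pt (F.obj ⟨y⟩).pt,
      ∀ z, b.FactorsThrough z → a.FactorsThrough (f.symm z) := by
    refine ⟨F.map (x := ⟨x⟩) (y := ⟨y⟩) a, fun z ⟨b₁, b₂, h⟩ ↦ ?_⟩
    have h₁ := key _ hFG (G.obj ⟨z⟩) ⟨G.map (x := F.obj ⟨x⟩) (y := ⟨z⟩) b₁,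
      G.map (x := ⟨z⟩) (y := F.obj ⟨y⟩) b₂,
      (G.map_comp (x := F.obj ⟨x⟩) (y := ⟨z⟩) (z := F.obj ⟨y⟩) b₁ b₂).symm.trans
        (congrArg (G.map (x := F.obj ⟨x⟩) (y := F.obj ⟨y⟩)) h)⟩
    rwa [hg] at h₁
  rwa [hf, hf] at key₂

end Spacetime

end Factorization

/-! ### Conformality -/

section Conformal

universe u v

variable {n m : ℕ} {X : Type u} [TopologicalSpace X]
  [ChartedSpace (EuclideanSpace ℝ (Fin n)) X]
  {Y : Type v} [TopologicalSpace Y] [ChartedSpace (EuclideanSpace ℝ (Fin m)) Y]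

theorem Diffeomorph.mfderiv_symm_mfderiv (f : X ≃ₘ⟮𝓡 n, 𝓡 m⟯ Y) (x : X)
    (v : TangentSpace (𝓡 n) x) :
    mfderiv (𝓡 m) (𝓡 n) f.symm (f x) (mfderiv (𝓡 n) (𝓡 m) f x v) = v := by
  have h1 := mfderiv_comp_apply x (f.symm.contMDiff.mdifferentiableAt (by simp) (x := f x))
    (f.contMDiff.mdifferentiableAt (by simp)) v
  rw [← h1]
  have e : f.symm ∘ f = id := funext f.symm_apply_apply
  rw [e, mfderiv_id]
  rfl

variable [IsManifold (𝓡 n) ∞ X] [IsManifold (𝓡 m) ∞ Y]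

namespace Spacetime

theorem hasDerivAt_comp_coordLine {p : X} {f : X → Y}
    (hf : MDifferentiableAt (𝓡 n) (𝓡 m) f p) (v : TangentSpace (𝓡 n) p) :
    HasDerivAt (fun t ↦ extChartAt (𝓡 m) (f p) (f (coordLine p (extChartAt (𝓡 n) p p) v t)))
      (coordOfVector (f p) (f p) (mfderiv (𝓡 n) (𝓡 m) f p v)) 0 := by
  set e := extChartAt (𝓡 n) p p
  set w : EuclideanSpace ℝ (Fin n) := v with hw
  have hs0 : e + (0 : ℝ) • w ∈ (extChartAt (𝓡 n) p).target := by
    rw [zero_smul, add_zero]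
    exact mem_extChartAt_target p
  have h0 : coordLine p e w 0 = p := coordLine_zero p w
  have hγ := ((contMDiffAt_coordLine hs0).mdifferentiableAt (by simp)).hasMFDerivAt
  have hv := mfderiv_coordLine hs0
  have hf' : HasMFDerivAt (𝓡 n) (𝓡 m) f (coordLine p e w 0)
      (mfderiv (𝓡 n) (𝓡 m) f (coordLine p e w 0)) := by
    rw [h0]
    exact hf.hasMFDerivAt
  have hφ : HasMFDerivAt (𝓡 m) 𝓘(ℝ, EuclideanSpace ℝ (Fin m)) (extChartAt (𝓡 m) (f p))
      (f (coordLine p e w 0)) (mfderiv (𝓡 m) 𝓘(ℝ, EuclideanSpace ℝ (Fin m))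
        (extChartAt (𝓡 m) (f p)) (f (coordLine p e w 0))) := by
    rw [h0]
    exact (mdifferentiableAt_extChartAt (mem_chart_source _ _)).hasMFDerivAt
  have h3 := hφ.comp 0 (hf'.comp 0 hγ)
  set L : ℝ →L[ℝ] EuclideanSpace ℝ (Fin m) :=
    (mfderiv (𝓡 m) 𝓘(ℝ, EuclideanSpace ℝ (Fin m)) (extChartAt (𝓡 m) (f p))
      (f (coordLine p e w 0))).comp ((mfderiv (𝓡 n) (𝓡 m) f (coordLine p e w 0)).comp
        (mfderiv 𝓘(ℝ, ℝ) (𝓡 n) (coordLine p e w) 0)) with hL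
  have h4 : HasFDerivAt (fun t ↦ extChartAt (𝓡 m) (f p) (f (coordLine p e w t))) L 0 :=
    hasMFDerivAt_iff_hasFDerivAt.1 h3
  have h5 : L 1 = coordOfVector (f p) (f p) (mfderiv (𝓡 n) (𝓡 m) f p v) := by
    have e1 : L 1 = mfderiv (𝓡 m) 𝓘(ℝ, EuclideanSpace ℝ (Fin m)) (extChartAt (𝓡 m) (f p))
      (f (coordLine p e w 0)) (mfderiv (𝓡 n) (𝓡 m) f (coordLine p e w 0)
        (mfderiv 𝓘(ℝ, ℝ) (𝓡 n) (coordLine p e w) 0 (1 : ℝ))) := rfl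
    rw [e1, hv, ← coordOfVector_eq_mfderiv (by rw [h0]; exact mem_chart_source _ _), h0,
      vectorOfCoord_self]
  rw [← h5]
  exact h4.hasDerivAt

/-- If `f` reflects factorizations, then its derivative maps future timelike vectors into the dual
of the future timelike cone. -/
theorem ReflectsFactorizations.inner_mfderiv_nonpos [T2Space X] {S : Spacetime n X}
    {T : Spacetime m Y} {k : CausalType} {f : X ≃ Y} (h : ReflectsFactorizations S T k f)
    (hf : ContMDiff (𝓡 n) (𝓡 m) ∞ f) {p : X} {v : TangentSpace (𝓡 n) p}
    (hv : S.IsFutureVector .timelike p v) {u : TangentSpace (𝓡 m) (f p)}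
    (hu : T.IsFutureVector .timelike (f p) u) :
    T.metric.inner (f p) u (mfderiv (𝓡 n) (𝓡 m) f p v) ≤ 0 := by
  obtain ⟨K', hK', N', hN', hNo', hNs', hb'⟩ := T.exists_cone_bound hu
  have hB' : T.ConeBound (f p) K' (T.timeForm (f p) u) N' := ⟨hNs', hb'⟩
  have ht : S.IsFutureVector .timelike p (S.timeField p) :=
    ⟨S.timeField_timelike p, S.timeField_timelike p⟩
  obtain ⟨K, hK, N, hN, -, hNs, hb⟩ := S.exists_cone_bound ht
  have hB : S.ConeBound p K (S.timeForm p (S.timeField p)) N := ⟨hNs, hb⟩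
  -- The ball must fit the cone bound in `X`, and its image under `f` must fit the cone bound in
  -- `Y`.
  obtain ⟨r, hr, hrN, hrt⟩ := exists_chartBall_subset (n := n)
    (Filter.inter_mem hN (hf.continuous.continuousAt.preimage_mem_nhds hN'))
  have hpr : p ∈ chartBall (n := n) p r := ⟨mem_chart_source _ p, Metric.mem_ball_self hr⟩
  set γ := coordLine p (extChartAt (𝓡 n) p p) v with hγ
  have hγ0 : γ 0 = p := coordLine_zero p v
  have hcont : ContinuousAt (fun t ↦ extChartAt (𝓡 n) p (γ t)) 0 :=
    (hasDerivAt_comp_coordLine (f := id) mdifferentiableAt_id v).continuousAt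
  have hsmall : ∀ᶠ t in 𝓝[>] (0 : ℝ), K * S.timeForm p (S.timeField p)
      (extChartAt (𝓡 n) p (γ t) - extChartAt (𝓡 n) p p) < r := by
    have : ContinuousAt (fun t ↦ K * S.timeForm p (S.timeField p)
      (extChartAt (𝓡 n) p (γ t) - extChartAt (𝓡 n) p p)) 0 :=
      continuousAt_const.mul ((S.timeForm p (S.timeField p)).continuous.continuousAt.comp
        (hcont.sub continuousAt_const))
    refine nhdsWithin_le_nhds (this.eventually (gt_mem_nhds ?_))
    simp only [hγ0, sub_self, map_zero, mul_zero]
    exact hr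
  have key : ∀ᶠ t in 𝓝[>] (0 : ℝ), 0 ≤ T.timeForm (f p) u
      (extChartAt (𝓡 m) (f p) (f (γ t)) - extChartAt (𝓡 m) (f p) (f p)) := by
    filter_upwards [hsmall, S.eventually_exists_futurePath k hv
      ((isOpen_chartBall p r).mem_nhds hpr)] with t hts ⟨c, hc, hcU⟩
    obtain ⟨b, hb⟩ := h p (γ t) (homotopyClassMk c hc)
    obtain ⟨⟨d, hd⟩, rfl⟩ := Quotient.exists_rep b
    -- At an interior `s`, the class of `d` factors through `d s`, so some path homotopic to `c`
    -- passes through `f.symm (d s)`; such paths cannot leave the ball.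
    have hmem : ∀ s, f.symm (d s) ∈ chartBall (n := n) p r := by
      intro s
      rcases (show 0 ≤ s from s.2.1).eq_or_lt with rfl | hs₀
      · rw [d.source, f.symm_apply_apply]
        exact hpr
      rcases (show s ≤ 1 from s.2.2).eq_or_lt with rfl | hs₁
      · rw [d.target, f.symm_apply_apply]
        have := hcU 1
        rwa [c.target] at this
      obtain ⟨c', hcc', t', ht'⟩ := exists_path_of_factorsThrough
        (hb _ (factorsThrough_mk hd hs₀ hs₁))
      rw [← ht']
      exact hB.homotopic_mem_chartBall hK (hrN.trans inter_subset_left) hrt hts hcc' hcU t'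
    have hle := hB'.of_isFuturePath hNo' hd (fun s ↦ by
      have := (hrN (hmem s)).2
      rwa [mem_preimage, f.apply_symm_apply] at this) (s := 0) (t := 1) zero_le_one
    rw [d.source, d.target] at hle
    exact hle.nonneg hK'
  -- The form is nonnegative on the displacement of `f ∘ γ` for small `t > 0`, so its right
  -- difference quotients at `0` are nonnegative, and so is their limit.
  have hd := ((T.timeForm (f p) u).hasFDerivAt.comp_hasDerivAt (0 : ℝ)
    ((hasDerivAt_comp_coordLine (hf.mdifferentiableAt (by simp)) v).sub_const
      (extChartAt (𝓡 m) (f p) (f p)))).tendsto_slope.mono_left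
      (nhdsGT_le_nhdsNE 0)
  have hlim := ge_of_tendsto hd (b := 0) (by
    filter_upwards [key, self_mem_nhdsWithin] with t ht ht0
    have ht0 : (0 : ℝ) < t := ht0
    rw [slope_def_field]
    refine div_nonneg ?_ (by linarith)
    have e : coordLine p (extChartAt (𝓡 n) p p) v 0 = p := hγ0
    simp only [Function.comp_apply, e, sub_self, map_zero, sub_zero]
    exact ht)
  rw [timeForm_apply, vectorOfCoord_coordOfVector (mem_chart_source _ _)] at hlim
  linarith

/-- For future `v`, the image lies in the dual of the future cone, which contains no spacelike
vector. Past vectors follow since the quadratic form is even. -/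
theorem ReflectsFactorizations.inner_mfderiv_self_nonpos [T2Space X] {S : Spacetime n X}
    {T : Spacetime m Y} {k : CausalType} {f : X ≃ Y} (h : ReflectsFactorizations S T k f)
    (hf : ContMDiff (𝓡 n) (𝓡 m) ∞ f) {p : X} {v : TangentSpace (𝓡 n) p}
    (hv : S.metric.inner p v v < 0) :
    T.metric.inner (f p) (mfderiv (𝓡 n) (𝓡 m) f p v) (mfderiv (𝓡 n) (𝓡 m) f p v) ≤ 0 := by
  have future : ∀ w : TangentSpace (𝓡 n) p, S.IsFutureVector .timelike p w →
      T.metric.inner (f p) (mfderiv (𝓡 n) (𝓡 m) f p w) (mfderiv (𝓡 n) (𝓡 m) f p w) ≤ 0 := by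
    intro w hw
    refine IsLorentzForm.nonpos_of_dual (B := T.metric.form (f p)) (T.timeField_timelike (f p))
      (T.metric.isLorentzForm (f p)) fun u hu hut ↦ ?_
    rw [LorentzianMetric.form_apply, T.metric.symm]
    exact h.inner_mfderiv_nonpos hf hw ⟨hu, hut⟩
  have hne := (S.metric.isLorentzForm p).ne_zero_of_causal (S.timeField_timelike p) hv.le
    (v := v) (by rintro rfl; simp at hv)
  rcases lt_or_gt_of_ne hne with hlt | hgt
  · exact future v ⟨hv, hlt⟩
  · have := future (-v) ⟨by simpa using hv, by simpa using hgt⟩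
    simpa using this

/-- A diffeomorphism that reflects factorizations in both directions is conformal. -/
theorem isConformalDiffeomorph_of_reflectsFactorizations [T2Space X] [T2Space Y]
    {S : Spacetime n X} {T : Spacetime m Y} {k : CausalType} (f : X ≃ₘ⟮𝓡 n, 𝓡 m⟯ Y)
    (h : ReflectsFactorizations S T k f.toEquiv)
    (h' : ReflectsFactorizations T S k f.symm.toEquiv) :
    IsConformalDiffeomorph S.metric T.metric f := by
  have hf : ContMDiff (𝓡 n) (𝓡 m) ∞ f := f.contMDiff
  set b : ∀ x, LinearMap.BilinForm ℝ (TangentSpace (𝓡 n) x) := fun x ↦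
    (T.metric.form (f x)).comp (mfderiv (𝓡 n) (𝓡 m) f x).toLinearMap
      (mfderiv (𝓡 n) (𝓡 m) f x).toLinearMap with hb
  have hba : ∀ x v w, b x v w = T.metric.inner (f x) (mfderiv (𝓡 n) (𝓡 m) f x v)
      (mfderiv (𝓡 n) (𝓡 m) f x w) := fun x v w ↦ rfl
  have main : ∀ x (t : TangentSpace (𝓡 n) x), S.metric.inner x t t < 0 → ∀ v w,
      S.metric.inner x t t * b x v w = b x t t * S.metric.inner x v w := by
    intro x t ht
    refine (S.metric.isLorentzForm x).exists_eq_smul (b := b x) (fun v w ↦ T.metric.symm _ _ _)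
      (fun v hv ↦ h.inner_mfderiv_self_nonpos hf hv) (fun v hv ↦ ?_) ht
    -- The converse comparison applies the result for the inverse map to the vector `df v` at `f x`.
    have h2 := h'.inner_mfderiv_self_nonpos f.symm.contMDiff (p := f x) hv
    change S.metric.inner (f.symm (f x)) (mfderiv (𝓡 m) (𝓡 n) f.symm (f x)
      (mfderiv (𝓡 n) (𝓡 m) f x v)) (mfderiv (𝓡 m) (𝓡 n) f.symm (f x)
      (mfderiv (𝓡 n) (𝓡 m) f x v)) ≤ 0 at h2
    rw [f.mfderiv_symm_mfderiv, f.symm_apply_apply] at h2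
    exact h2
  have hneg : ∀ x (t : TangentSpace (𝓡 n) x), S.metric.inner x t t < 0 → b x t t < 0 := by
    intro x t ht
    -- If `b x t t` vanished, `main` would make the whole pullback form vanish, although `df` is
    -- onto and reaches the timelike vector `T.timeField (f x)`.
    refine lt_of_le_of_ne (h.inner_mfderiv_self_nonpos hf ht) fun h0 ↦ ?_
    obtain ⟨v, hv⟩ := (f.mfderivToContinuousLinearEquiv (by simp) x).surjective
      (T.timeField (f x))
    have hv' : mfderiv (𝓡 n) (𝓡 m) f x v = T.timeField (f x) := hv
    have h1 := main x t ht v v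
    rw [h0, zero_mul, hba, hv'] at h1
    exact (mul_pos_of_neg_of_neg ht (T.timeField_timelike (f x))).ne' h1
  set Ω : X → ℝ := fun x ↦ b x (S.timeField x) (S.timeField x) /
    S.metric.inner x (S.timeField x) (S.timeField x) with hΩ
  have hΩeq : ∀ x v w, b x v w = Ω x * S.metric.inner x v w := by
    intro x v w
    rw [hΩ, div_mul_eq_mul_div, eq_div_iff (S.timeField_timelike x).ne,
      ← main x _ (S.timeField_timelike x) v w, mul_comm]
  refine ⟨Ω, fun x₀ ↦ ?_, fun x ↦ div_pos_of_neg_of_neg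
    (hneg x _ (S.timeField_timelike x)) (S.timeField_timelike x), fun x v w ↦ hΩeq x v w⟩
  -- The time field is only continuous. Since `Ω` is the ratio of the two forms on any timelike
  -- vector, it is computed near `x₀` with the smooth field of constant chart coordinates.
  set V : X → TangentBundle (𝓡 n) X := fun x ↦
    ⟨x, vectorOfCoord x₀ x (S.timeField x₀)⟩ with hV
  have hVs : ContMDiffAt (𝓡 n) (𝓡 n).tangent ∞ V x₀ :=
    contMDiffAt_vectorOfCoord (mem_chart_source _ x₀) _
  have hnum : ContMDiffAt (𝓡 n) 𝓘(ℝ, ℝ) ∞ (fun x ↦ b x (V x).2 (V x).2) x₀ :=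
    (T.metric.contMDiff_quadratic.comp (hf.contMDiff_tangentMap le_rfl)).contMDiffAt.comp x₀ hVs
  have hden : ContMDiffAt (𝓡 n) 𝓘(ℝ, ℝ) ∞ (fun x ↦ S.metric.inner x (V x).2 (V x).2) x₀ :=
    S.metric.contMDiff_quadratic.contMDiffAt.comp x₀ hVs
  have h0 : S.metric.inner x₀ (V x₀).2 (V x₀).2 < 0 := by
    have e : (V x₀).2 = S.timeField x₀ := vectorOfCoord_self x₀ _
    rw [e]
    exact S.timeField_timelike x₀
  refine (hnum.div₀ hden h0.ne).congr_of_eventuallyEq ?_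
  filter_upwards [hden.continuousAt.eventually (gt_mem_nhds h0)] with x hx
  change Ω x = b x (V x).2 (V x).2 / S.metric.inner x (V x).2 (V x).2
  rw [hΩeq, mul_div_cancel_right₀ _ hx.ne]

end Spacetime

end Conformal

/-! ### ### The corollary, causal and timelike -/

theorem mainTheorem4 {n m : ℕ}
    {X : Type*} [TopologicalSpace X] [T2Space X] [SecondCountableTopology X]
    [ChartedSpace (EuclideanSpace ℝ (Fin n)) X] [IsManifold (𝓡 n) ∞ X]
    {Y : Type*} [TopologicalSpace Y] [T2Space Y] [SecondCountableTopology Y]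
    [ChartedSpace (EuclideanSpace ℝ (Fin m)) Y] [IsManifold (𝓡 m) ∞ Y]
    (S : Spacetime n X) (T : Spacetime m Y) :
    (∀ F : CausalCategory S ⥤ CausalCategory T, F.IsIsomorphism →
      ∀ f : X ≃ₘ⟮𝓡 n, 𝓡 m⟯ Y, (∀ x : X, F.obj ⟨x⟩ = ⟨f x⟩) →
        IsConformalDiffeomorph S.metric T.metric f) ∧
    (∀ F : Semifunctor (TimelikeSemicategory S) (TimelikeSemicategory T), F.IsIsomorphism →
      ∀ f : X ≃ₘ⟮𝓡 n, 𝓡 m⟯ Y, (∀ x : X, F.obj ⟨x⟩ = ⟨f x⟩) →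
        IsConformalDiffeomorph S.metric T.metric f) := by
  constructor
  · rintro F ⟨G, hFG, hGF⟩ f hf
    -- The identity `G (F x) = x` forces the object map of the inverse functor to be `f⁻¹`, so the
    -- argument is symmetric in the two spacetimes.
    have hg : ∀ y, G.obj ⟨y⟩ = ⟨f.symm y⟩ := fun y ↦ by
      have h := Functor.congr_obj hFG ⟨f.symm y⟩
      rwa [Functor.comp_obj, hf, f.apply_symm_apply] at h
    exact Spacetime.isConformalDiffeomorph_of_reflectsFactorizations f
      (Spacetime.reflectsFactorizations_of_functor hFG hf hg)
      (Spacetime.reflectsFactorizations_of_functor hGF hg hf)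
  · rintro F ⟨G, hFG, hGF⟩ f hf
    have hg : ∀ y, G.obj ⟨y⟩ = ⟨f.symm y⟩ := fun y ↦ by
      have h := congrArg (fun H ↦ Semifunctor.obj H ⟨f.symm y⟩) hFG
      change G.obj (F.obj ⟨f.symm y⟩) = ⟨f.symm y⟩ at h
      rwa [hf, f.apply_symm_apply] at h
    exact Spacetime.isConformalDiffeomorph_of_reflectsFactorizations f
      (Spacetime.reflectsFactorizations_of_semifunctor hFG hf hg)
      (Spacetime.reflectsFactorizations_of_semifunctor hGF hg hf)
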